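/- Let $\mathbf{Mon}$ be the category of sharp, finitely generated, integral, saturated commutative monoids, dual to the category of rational polyhedral cones with integral structure: $M$ corresponds to the cone $M^\vee=\mathrm{Hom}(M,\mathbb R_{\ge 0})$ in $\mathrm{Hom}(M^{\mathrm{gp}},\mathbb R)$ with lattice $N_M=\mathrm{Hom}(M^{\mathrm{gp}},\mathbb Z)$. Write $x\le y$ in $M^{\mathrm{gp}}$ if $y-x\in M$. A tropical curve $\Gamma$ metrized by $M$ is a finite connected graph with an ordered non-empty list of legs and with edge lengths $\ell_e\in M\setminus\{0\}$. A piecewise linear function on $\Gamma$ is a map $\alpha:V(\Gamma)\to M^{\mathrm{gp}}$ such that for every oriented edge $\vec e$ from $v$ to $w$ one has $\alpha(w)-\alpha(v)=s(\vec e)\,\ell_e$ for some $s(\vec e)\in\mathbb Z$. A tropical line $X$ metrized by $M$ is given by finitely many vertices $\gamma_1<\dots<\gamma_n$ in $M^{\mathrm{gp}}$, consecutive ones being joined by an edge of length $\gamma_{i+1}-\gamma_i$. An equidimensional lift of $\alpha$ consists of a subdivision $\Gamma'\to\Gamma$ with edge lengths in $M\setminus\{0\}$ and a tropical line $X$ such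 that $\alpha$, extended linearly to $\Gamma'$, maps every vertex of $\Gamma'$ to a vertex of $X$ and every edge of $\Gamma'$ onto an edge or a vertex of $X$. The lift is stable (minimal) if every vertex of $X$ is the image of a vertex of $\Gamma$ and no edge on which $\alpha$ has slope $0$ is subdivided. For $M\in\mathbf{Mon}$ let $\Sigma_{\mathbf{Div}}(M)$ be the groupoid of pairs $(\Gamma,\alpha)$, where $\Gamma$ is metrized by $M$ and $\alpha$ is a piecewise linear function on $\Gamma$ that vanishes at the vertex containing the first leg; let $\Sigma_{\mathbf{Ord}}(M)$ be the full subgroupoid of those $(\Gamma,\alpha)$ for which the values $\alpha(v)$ are totally ordered by $\le$; and let $\Sigma_{\mathbf{Rub}}(M)$ be the groupoid of triples consisting of $(\Gamma,\alpha)\in\Sigma_{\mathbf{Div}}(M)$ and a stable equidimensional lift of $\alpha$. A homomorphism $f:M\to P$ acts by applying $f$ to lengths and values and contracting the edges whose length becomes $0$. Let $\Sigma_{\mathbf{Rub}}\to\Sigma_{\mathbf{Ord}}\to\Sigma_{\mathbf{Div}}$ be the forgetful maps. The same definitions give groupoids of real points, with $\mathbb R_{\ge 0}$ in place of $M$. Then: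 1. $\Sigma_{\mathbf{Ord}}\to\Sigma_{\mathbf{Div}}$ is a subdivision: for every $M\in\mathbf{Mon}$ and every $y\in\Sigma_{\mathbf{Div}}(M)$ there is a finite fan $\Delta$ of rational polyhedral cones in $\mathrm{Hom}(M^{\mathrm{gp}},\mathbb R)$ with support $M^\vee$ such that the fibre product of $\Sigma_{\mathbf{Ord}}$ and $M^\vee$ over $\Sigma_{\mathbf{Div}}$, with its projection to $M^\vee$, is represented by $\Delta\to M^\vee$; that is, it is equivalent to the subfunctor of $P\mapsto\mathrm{Hom}(M,P)$ of those $f$ whose dual map $P^\vee\to M^\vee$ has image in some cone of $\Delta$. 2. $\Sigma_{\mathbf{Rub}}\to\Sigma_{\mathbf{Ord}}$ is a finite index inclusion: for every $M\in\mathbf{Mon}$ and every $y\in\Sigma_{\mathbf{Ord}}(M)$ there is a subgroup $N'\subset N_M$ of finite index such that the fibre product of $\Sigma_{\mathbf{Rub}}$ and $M^\vee$ over $\Sigma_{\mathbf{Ord}}$, with its projection to $M^\vee$, is represented by the same cone with lattice $N'$; that is, it is equivalent to the subfunctor of $P\mapsto\mathrm{Hom}(M,P)$ of those $f$ whose dual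 map sends $N_P$ into $N'$. Moreover, the map on real points $\Sigma_{\mathbf{Rub}}(\mathbb R_{\ge 0})\to\Sigma_{\mathbf{Ord}}(\mathbb R_{\ge 0})$ is an equivalence of groupoids (in particular bijective on isomorphism classes). -/

import Mathlib

open CategoryTheory

noncomputable section

namespace TropRub

/-! ### Monoids -/

/-- The group `M^gp` of a commutative monoid. -/
abbrev Gp (M : Type) [AddCommMonoid M] : Type := Algebra.GrothendieckAddGroup M

/-- The canonical map `M → M^gp`. -/
abbrev of {M : Type} [AddCommMonoid M] : M →+ Gp M := Algebra.GrothendieckAddGroup.of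

/-- The map `M^gp → P^gp` induced by `f : M → P`. -/
def gpMap {M P : Type} [AddCommMonoid M] [AddCommMonoid P] (f : M →+ P) : Gp M →+ Gp P :=
  Algebra.GrothendieckAddGroup.lift (of.comp f)

/-- The partial order of `M^gp` defined by `M`: `x ≤ y` means `y - x ∈ M`. -/
def GpLE {M : Type} [AddCommMonoid M] (x y : Gp M) : Prop := ∃ m : M, y - x = of m

theorem gpMap_of {M P : Type} [AddCommMonoid M] [AddCommMonoid P] (f : M →+ P) (m : M) :
    gpMap f (of m) = of (f m) :=
  DFunLike.congr_fun (Algebra.GrothendieckAddGroup.lift.symm_apply_apply (of.comp f)) m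

theorem gp_hom_ext {M G : Type} [AddCommMonoid M] [AddCommGroup G] {f g : Gp M →+ G}
    (h : ∀ m, f (of m) = g (of m)) : f = g :=
  Algebra.GrothendieckAddGroup.lift.symm.injective (AddMonoidHom.ext h)

theorem gpMap_id {M : Type} [AddCommMonoid M] : gpMap (AddMonoidHom.id M) = AddMonoidHom.id _ :=
  gp_hom_ext fun m => gpMap_of _ m

theorem gpMap_comp {M P Q : Type} [AddCommMonoid M] [AddCommMonoid P] [AddCommMonoid Q]
    (f : M →+ P) (g : P →+ Q) : gpMap (g.comp f) = (gpMap g).comp (gpMap f) :=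
  gp_hom_ext fun m => by
    rw [gpMap_of, AddMonoidHom.comp_apply, AddMonoidHom.comp_apply, gpMap_of, gpMap_of]

/-- Sharp, integral, saturated commutative monoids (not necessarily finitely generated). -/
structure SharpMon where
  carrier : Type
  [inst : AddCommMonoid carrier]
  /-- integral: `M → M^gp` is injective -/
  integral : ∀ a b c : carrier, a + b = a + c → b = c
  /-- sharp: no non-trivial units -/
  sharp : ∀ a b : carrier, a + b = 0 → a = 0
  /-- saturated: if `x = a - b ∈ M^gp` has a positive multiple in `M`, then `x ∈ M` -/
  saturated : ∀ (n : ℕ) (a b c : carrier), n ≠ 0 → n • a = n • b + c → ∃ d, a = b + d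

attribute [instance] SharpMon.inst

instance : Category SharpMon where
  Hom M P := M.carrier →+ P.carrier
  id M := AddMonoidHom.id M.carrier
  comp f g := AddMonoidHom.comp g f

/-- The monoid homomorphism underlying a morphism. -/
def SharpMon.hom {M P : SharpMon} (f : M ⟶ P) : M.carrier →+ P.carrier := f

theorem SharpMon.hom_id (M : SharpMon) : SharpMon.hom (𝟙 M) = AddMonoidHom.id _ := rfl

theorem SharpMon.hom_comp {M P Q : SharpMon} (f : M ⟶ P) (g : P ⟶ Q) :
    SharpMon.hom (f ≫ g) = (SharpMon.hom g).comp (SharpMon.hom f) := rfl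

/-- Finite generation. -/
def IsFG : ObjectProperty SharpMon := fun M => AddMonoid.FG M.carrier

/-- The category **Mon** of sharp, finitely generated, integral, saturated monoids; it is dual to
the category of rational polyhedral cones with integral structure. -/
abbrev Mon : Type 1 := IsFG.FullSubcategory

/-- The inclusion of **Mon**. -/
abbrev Mon.incl : Mon ⥤ SharpMon := IsFG.ι

/-- The monoid `ℝ≥0`, which gives real points. -/
def realMon : SharpMon where
  carrier := NNReal
  integral := fun _ _ _ h => add_left_cancel h
  sharp := fun a b h => (add_eq_zero.mp h).1
  saturated := fun n a b c hn h => by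
    have h1 : n • b ≤ n • a := by rw [h]; exact le_self_add
    have h2 : b ≤ a := le_of_nsmul_le_nsmul_right hn h1
    exact exists_add_of_le h2

/-- The one-object base over the monoid `ℝ≥0` (only the identity of `ℝ≥0` is a morphism). -/
abbrev realBase : Discrete PUnit.{1} ⥤ SharpMon := Functor.fromPUnit realMon

/-! ### Tropical curves and piecewise linear functions -/

/-- A tropical curve metrized by `M`: a finite connected graph (loops and multiple edges are
allowed) with at least one leg, and non-zero lengths in `M`. `E` is the set of oriented
edges; `rev` reverses the orientation. `legs` lists the vertices that carry the legs
`h₁, …, hₙ`, in this order. -/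
structure TropCurve (M : Type) [AddCommMonoid M] where
  V : Type
  E : Type
  finite_V : Finite V
  finite_E : Finite E
  src : E → V
  rev : E → E
  rev_rev : ∀ e, rev (rev e) = e
  rev_ne : ∀ e, rev e ≠ e
  len : E → M
  len_rev : ∀ e, len (rev e) = len e
  len_ne_zero : ∀ e, len e ≠ 0
  legs : List V
  legs_ne_nil : legs ≠ []
  connected : ∀ v w, Relation.ReflTransGen (fun a b => ∃ e, src e = a ∧ src (rev e) = b) v w

/-- The end point of an oriented edge. -/
def TropCurve.tgt {M : Type} [AddCommMonoid M] (C : TropCurve M) (e : C.E) : C.V :=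
  C.src (C.rev e)

/-- A tropical curve with a piecewise linear function `α` that vanishes at the vertex containing
the (first) leg. -/
structure PLCurve (M : Type) [AddCommMonoid M] extends TropCurve M where
  α : V → Gp M
  isPL : ∀ e, ∃ s : ℤ, α (toTropCurve.tgt e) - α (src e) = s • of (len e)
  α_leg : α (legs.head legs_ne_nil) = 0

/-- The slope of `α` along an oriented edge (it is unique for `M` sharp, integral, saturated, since
then `M^gp` is torsion free). -/
def PLCurve.slope {M : Type} [AddCommMonoid M] (C : PLCurve M) (e : C.E) : ℤ :=
  Classical.choose (C.isPL e)

/-- The values of `α` are totally ordered. -/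
def PLCurve.TotallyOrdered {M : Type} [AddCommMonoid M] (C : PLCurve M) : Prop :=
  ∀ v w, GpLE (C.α v) (C.α w) ∨ GpLE (C.α w) (C.α v)

/-- `vert` and `edge` exhibit `D` as the curve over `P` obtained from `C` by changing the lengths and
the function along `f : M → P`, and contracting the edges whose length becomes `0`. The oriented
edges of `D` are, via `edge`, those of `C` that are not contracted. For `f = id` this is an
isomorphism of curves with legs and functions. -/
structure IsContraction {M P : Type} [AddCommMonoid M] [AddCommMonoid P] (f : M →+ P)
    (C : PLCurve M) (D : PLCurve P) (vert : C.V → D.V) (edge : D.E → C.E) : Prop where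
  edge_injective : Function.Injective edge
  edge_range : ∀ e, (∃ e', edge e' = e) ↔ f (C.len e) ≠ 0
  edge_rev : ∀ e', edge (D.rev e') = C.rev (edge e')
  edge_src : ∀ e', vert (C.src (edge e')) = D.src e'
  edge_len : ∀ e', D.len e' = f (C.len (edge e'))
  vert_surjective : Function.Surjective vert
  vert_eq_iff : ∀ v w, vert v = vert w ↔
    Relation.ReflTransGen (fun a b => ∃ e, C.src e = a ∧ C.tgt e = b ∧ f (C.len e) = 0) v w
  legs : D.legs = C.legs.map vert
  α : ∀ v, D.α (vert v) = gpMap f (C.α v)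

theorem IsContraction.id {M : Type} [AddCommMonoid M] (C : PLCurve M) :
    IsContraction (AddMonoidHom.id M) C C id id where
  edge_injective := Function.injective_id
  edge_range e := by simpa using C.len_ne_zero e
  edge_rev _ := rfl
  edge_src _ := rfl
  edge_len _ := rfl
  vert_surjective := Function.surjective_id
  vert_eq_iff v w := by
    constructor
    · rintro rfl; exact .refl
    · intro h
      induction h with
      | refl => rfl
      | tail _ h _ => obtain ⟨e, _, _, h⟩ := h; exact absurd h (C.len_ne_zero e)
  legs := by simp
  α v := by rw [gpMap_id]; rfl

theorem IsContraction.comp {M P Q : Type} [AddCommMonoid M] [AddCommMonoid P] [AddCommMonoid Q]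
    {f : M →+ P} {g : P →+ Q} {C : PLCurve M} {D : PLCurve P} {F : PLCurve Q}
    {v₁ : C.V → D.V} {e₁ : D.E → C.E} {v₂ : D.V → F.V} {e₂ : F.E → D.E}
    (h₁ : IsContraction f C D v₁ e₁) (h₂ : IsContraction g D F v₂ e₂) :
    IsContraction (g.comp f) C F (v₂ ∘ v₁) (e₁ ∘ e₂) where
  edge_injective := h₁.edge_injective.comp h₂.edge_injective
  edge_range e := by
    constructor
    · rintro ⟨e', rfl⟩
      have := (h₂.edge_range (e₂ e')).1 ⟨e', rfl⟩
      rwa [h₁.edge_len] at this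
    · intro h
      have hf : f (C.len e) ≠ 0 := fun h0 => h (by simp [h0])
      obtain ⟨e', rfl⟩ := (h₁.edge_range e).2 hf
      have hg : g (D.len e') ≠ 0 := by rw [h₁.edge_len]; exact h
      obtain ⟨e'', rfl⟩ := (h₂.edge_range e').2 hg
      exact ⟨e'', rfl⟩
  edge_rev e' := by simp [h₂.edge_rev, h₁.edge_rev]
  edge_src e' := by simp [h₂.edge_src, h₁.edge_src]
  edge_len e' := by simp [h₂.edge_len, h₁.edge_len]
  vert_surjective := h₂.vert_surjective.comp h₁.vert_surjective
  vert_eq_iff v w := by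
    have mono : ∀ a b, v₁ a = v₁ b → Relation.ReflTransGen (fun a b => ∃ e, C.src e = a ∧
        C.tgt e = b ∧ (g.comp f) (C.len e) = 0) a b := fun a b hab =>
      Relation.ReflTransGen.mono (fun _ _ ⟨e, h1, h2, h3⟩ => ⟨e, h1, h2, by simp [h3]⟩) _ _
        ((h₁.vert_eq_iff a b).1 hab)
    simp only [Function.comp_apply]
    rw [h₂.vert_eq_iff]
    constructor
    · intro h
      obtain ⟨b, hb⟩ : ∃ b, b = v₁ w := ⟨_, rfl⟩
      rw [← hb] at h
      induction h generalizing w with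
      | refl => exact mono _ _ hb
      | @tail b c _ hbc ih =>
        obtain ⟨e, hs, ht, h0⟩ := hbc
        have hs' : b = v₁ (C.src (e₁ e)) := by rw [h₁.edge_src, hs]
        have ht' : c = v₁ (C.tgt (e₁ e)) := by
          rw [← ht]; unfold TropCurve.tgt; rw [← h₁.edge_rev, h₁.edge_src]
        refine ((ih _ hs').tail ⟨e₁ e, rfl, rfl, ?_⟩).trans (mono _ _ (ht'.symm.trans hb))
        rw [AddMonoidHom.comp_apply, ← h₁.edge_len, h0]
    · intro h
      induction h with
      | refl => exact .refl
      | tail _ h ih =>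
        obtain ⟨e, rfl, rfl, h0⟩ := h
        by_cases hf : f (C.len e) = 0
        · rwa [← (h₁.vert_eq_iff _ _).2 (.single ⟨e, rfl, rfl, hf⟩)]
        · obtain ⟨e', rfl⟩ := (h₁.edge_range e).2 hf
          refine ih.tail ⟨e', (h₁.edge_src e').symm, ?_, ?_⟩
          · unfold TropCurve.tgt; rw [← h₁.edge_rev, h₁.edge_src]
          · rw [h₁.edge_len]; exact h0
  legs := by rw [h₂.legs, h₁.legs, List.map_map]
  α v := by rw [gpMap_comp]; simp [h₂.α, h₁.α]

/-! ### The stacks `Σ_Div`, `Σ_Ord`, `Σ_Rub`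

They are given as categories over the base: an object consists of a monoid and of an object of the
groupoid over this monoid; a morphism over `f : M → P` identifies the target with the pushforward of
the source along `f`. They are formed over any `U : B ⥤ SharpMon`: for `U = Mon.incl` one gets the
stacks over **Mon**, for `U = realBase` the groupoids of `ℝ≥0`-points. -/

universe u v

/-- Objects of `Σ_Div`. -/
structure DivObj {B : Type u} [Category.{v} B] (U : B ⥤ SharpMon) where
  base : B
  curve : PLCurve (U.obj base).carrier

/-- Morphisms of `Σ_Div`. -/
@[ext]
structure DivHom {B : Type u} [Category.{v} B] {U : B ⥤ SharpMon} (X Y : DivObj U) where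
  base : X.base ⟶ Y.base
  vert : X.curve.V → Y.curve.V
  edge : Y.curve.E → X.curve.E
  isContraction : IsContraction (SharpMon.hom (U.map base)) X.curve Y.curve vert edge

/-- `Σ_Div`: tropical curves with a piecewise linear function. -/
instance {B : Type u} [Category.{v} B] (U : B ⥤ SharpMon) : Category (DivObj U) where
  Hom X Y := DivHom X Y
  id X := ⟨𝟙 _, id, id, by rw [U.map_id, SharpMon.hom_id]; exact .id _⟩
  comp h k := ⟨h.base ≫ k.base, k.vert ∘ h.vert, h.edge ∘ k.edge, by
    rw [U.map_comp, SharpMon.hom_comp]; exact h.isContraction.comp k.isContraction⟩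

/-- The projection of `Σ_Div` to the base. -/
def divBase {B : Type u} [Category.{v} B] (U : B ⥤ SharpMon) : DivObj U ⥤ B where
  obj X := X.base
  map h := h.base

/-- `Σ_Ord`: tropical curves with a piecewise linear function whose values are totally ordered. -/
abbrev OrdObj {B : Type u} [Category.{v} B] (U : B ⥤ SharpMon) : Type (max 1 u) :=
  ObjectProperty.FullSubcategory fun X : DivObj U => X.curve.TotallyOrdered

/-- The map `Σ_Ord → Σ_Div` that forgets the ordering. -/
abbrev ordToDiv {B : Type u} [Category.{v} B] (U : B ⥤ SharpMon) : OrdObj U ⥤ DivObj U :=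
  ObjectProperty.ι _

/-- A subdivision `C' → C` of a tropical curve, metrized by the same monoid: each oriented edge `e`
is replaced by a chain of edges, of non-zero lengths `pieces e` adding up to the length of `e`.
The interior vertices of the chains are the exceptional vertices. -/
structure Subdivision {M : Type} [AddCommMonoid M] (C : TropCurve M) where
  pieces : C.E → List M
  pieces_ne_zero : ∀ e, ∀ m ∈ pieces e, m ≠ 0
  sum_pieces : ∀ e, (pieces e).sum = C.len e
  pieces_rev : ∀ e, pieces (C.rev e) = (pieces e).reverse

/-- The value of the lift of `α` to a subdivision at the `j`-th vertex of the chain that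
replaces `e`, starting from `j = 0` for the source of `e`. -/
def Subdivision.val {M : Type} [AddCommMonoid M] {C : PLCurve M} (S : Subdivision C.toTropCurve)
    (e : C.E) (j : ℕ) : Gp M :=
  C.α (C.src e) + C.slope e • of ((S.pieces e).take j).sum

/-- A tropical line `X ⊂ ℝ` metrized by `M`, given by the images in `M^gp` of its vertices
`γ₁ < ⋯ < γₙ`. Its edges join consecutive vertices and have the lengths `γᵢ₊₁ - γᵢ ∈ M - 0`. -/
structure TropLine (M : Type) [AddCommMonoid M] where
  verts : Set (Gp M)
  finite_verts : verts.Finite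
  total : ∀ x ∈ verts, ∀ y ∈ verts, GpLE x y ∨ GpLE y x

/-- A lift of `α` to an equidimensional map `C' → X` from a subdivision of `C` to a tropical
line: vertices of `C'` map to vertices of `X`, and the interior of an edge of `C'` contains no
point that maps to a vertex of `X`, unless the edge is contracted. -/
structure EquidimLift {M : Type} [AddCommMonoid M] (C : PLCurve M) extends
    Subdivision C.toTropCurve where
  line : TropLine M
  vertex_mem : ∀ v, C.α v ∈ line.verts
  chain_mem : ∀ e, ∀ j ≤ (pieces e).length, toSubdivision.val e j ∈ line.verts
  edge_cell : ∀ e, ∀ j < (pieces e).length, ∀ x ∈ line.verts,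
    GpLE (toSubdivision.val e j) x → GpLE x (toSubdivision.val e (j + 1)) →
      x = toSubdivision.val e j ∨ x = toSubdivision.val e (j + 1)

/-- A stable, i.e. minimal, lift: every vertex of `X` is the image of a vertex of `C` (so that every
exceptional vertex has the same value as some non-exceptional one), and edges of
slope `0` are not subdivided. -/
structure StableLift {M : Type} [AddCommMonoid M] (C : PLCurve M) extends EquidimLift C where
  line_stable : ∀ x ∈ line.verts, ∃ v, C.α v = x
  contracted : ∀ e, C.slope e = 0 → pieces e = [C.len e]

theorem StableLift.totallyOrdered {M : Type} [AddCommMonoid M] {C : PLCurve M}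
    (L : StableLift C) : C.TotallyOrdered :=
  fun v w => L.line.total _ (L.vertex_mem v) _ (L.vertex_mem w)

open Classical in
/-- The list `l` mapped along `f`, with the zero lengths dropped. -/
def pushPieces {M P : Type} [AddCommMonoid M] [AddCommMonoid P] (f : M →+ P) (l : List M) :
    List P := (l.map f).filter (fun m => m ≠ 0)

/-- Objects of `Σ_Rub`. -/
structure RubObj {B : Type u} [Category.{v} B] (U : B ⥤ SharpMon) extends DivObj U where
  lift : StableLift curve

/-- Morphisms of `Σ_Rub`: morphisms of `Σ_Div` that carry the subdivision and the tropical line of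
the source to those of the target, after contraction of the edges whose length becomes `0`. -/
@[ext]
structure RubHom {B : Type u} [Category.{v} B] {U : B ⥤ SharpMon} (X Y : RubObj U) where
  toDiv : X.toDivObj ⟶ Y.toDivObj
  line : Y.lift.line.verts = gpMap (SharpMon.hom (U.map toDiv.base)) '' X.lift.line.verts
  pieces : ∀ e', Y.lift.pieces e' =
    pushPieces (SharpMon.hom (U.map toDiv.base)) (X.lift.pieces (toDiv.edge e'))

theorem pushPieces_id {M : Type} [AddCommMonoid M] (l : List M) (h : ∀ m ∈ l, m ≠ 0) :
    pushPieces (AddMonoidHom.id M) l = l := by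
  simpa [pushPieces, List.filter_eq_self] using h

theorem pushPieces_comp {M P Q : Type} [AddCommMonoid M] [AddCommMonoid P] [AddCommMonoid Q]
    (f : M →+ P) (g : P →+ Q) (l : List M) :
    pushPieces (g.comp f) l = pushPieces g (pushPieces f l) := by
  classical
  induction l with
  | nil => rfl
  | cons a l ih =>
    by_cases hf : f a = 0
    · simp_all [pushPieces]
    · by_cases hg : g (f a) = 0 <;> simp_all [pushPieces]

/-- `Σ_Rub`: tropical curves with a piecewise linear function and a stable equidimensional lift. -/
instance {B : Type u} [Category.{v} B] (U : B ⥤ SharpMon) : Category (RubObj U) where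
  Hom X Y := RubHom X Y
  id X := ⟨𝟙 X.toDivObj, by
      change _ = gpMap (SharpMon.hom (U.map (𝟙 X.base))) '' _
      rw [U.map_id, SharpMon.hom_id, gpMap_id]; simp, fun e => by
      change _ = pushPieces (SharpMon.hom (U.map (𝟙 X.base))) (X.lift.pieces e)
      rw [U.map_id, SharpMon.hom_id, pushPieces_id _ (X.lift.pieces_ne_zero e)]⟩
  comp {X Y Z} h k := ⟨h.toDiv ≫ k.toDiv, by
      change _ = gpMap (SharpMon.hom (U.map (h.toDiv.base ≫ k.toDiv.base))) '' _
      rw [U.map_comp, SharpMon.hom_comp, gpMap_comp, k.line, h.line, Set.image_image]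
      rfl, fun e => by
      change _ = pushPieces (SharpMon.hom (U.map (h.toDiv.base ≫ k.toDiv.base)))
        (X.lift.pieces (h.toDiv.edge (k.toDiv.edge e)))
      rw [U.map_comp, SharpMon.hom_comp, pushPieces_comp, k.pieces, h.pieces]⟩
  id_comp h := RubHom.ext (Category.id_comp h.toDiv)
  comp_id h := RubHom.ext (Category.comp_id h.toDiv)
  assoc h k l := RubHom.ext (Category.assoc h.toDiv k.toDiv l.toDiv)

/-- The map `Σ_Rub → Σ_Ord` that forgets the lift and keeps the fact that `α` is totally ordered. -/
def rubToOrd {B : Type u} [Category.{v} B] (U : B ⥤ SharpMon) : RubObj U ⥤ OrdObj U where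
  obj X := ⟨X.toDivObj, X.lift.totallyOrdered⟩
  map h := ObjectProperty.homMk h.toDiv
  map_id _ := rfl
  map_comp _ _ := rfl

/-! ### Cones, subdivisions and finite index inclusions -/

/-- The real vector space `N_ℝ = Hom(M^gp, ℝ)` that contains the cone dual to `M`. -/
abbrev NReal (M : Type) [AddCommMonoid M] : Type := Gp M →+ ℝ

/-- The lattice `N = Hom(M^gp, ℤ)` of the cone dual to `M`. -/
abbrev Lattice (M : Type) [AddCommMonoid M] : Type := Gp M →+ ℤ

/-- The cone `M^∨` dual to `M`. -/
def dualCone (M : Type) [AddCommMonoid M] : Set (NReal M) := {φ | ∀ m : M, 0 ≤ φ (of m)}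

/-- A rational polyhedral cone: it is cut out by finitely many integral linear inequalities. -/
def IsRationalCone {M : Type} [AddCommMonoid M] (τ : Set (NReal M)) : Prop :=
  ∃ S : Finset (Gp M), τ = {φ | ∀ x ∈ S, 0 ≤ φ x}

/-- `ρ` is a face of the rational polyhedral cone `τ`. -/
def IsFace {M : Type} [AddCommMonoid M] (ρ τ : Set (NReal M)) : Prop :=
  ∃ x : Gp M, (∀ φ ∈ τ, 0 ≤ φ x) ∧ ρ = {φ ∈ τ | φ x = 0}

/-- A finite set of cones that is a fan and a subdivision of the cone `M^∨`. -/
structure IsSubdivisionOfCone (M : Type) [AddCommMonoid M] (Δ : Set (Set (NReal M))) : Prop where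
  finite : Δ.Finite
  rational : ∀ τ ∈ Δ, IsRationalCone τ
  pointed : ∀ τ ∈ Δ, ∀ φ ∈ τ, -φ ∈ τ → φ = 0
  face_mem : ∀ τ ∈ Δ, ∀ ρ, IsFace ρ τ → ρ ∈ Δ
  inter_face : ∀ τ ∈ Δ, ∀ τ' ∈ Δ, IsFace (τ ∩ τ') τ ∧ IsFace (τ ∩ τ') τ'
  support : ⋃₀ Δ = dualCone M

/-- The functor from the fibre product of `F : 𝒳 → 𝒴` with the cone dual to `M = p y`, mapping to `𝒴` by
`y`, to this cone. Its source consists of the `x` in `𝒳` with an arrow `y ⟶ F x`, i.e. of the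
homomorphisms `f : M ⟶ P`, the `x` in `𝒳` over `P`, and the identifications of `F x` with `f_* y`;
it forgets all but `f`, which is the same as a map of cones from `P^∨` to `M^∨`. -/
def baseChange {𝒳 : Type*} {𝒴 : Type*} [Category 𝒳] [Category 𝒴] (F : 𝒳 ⥤ 𝒴) (p : 𝒴 ⥤ Mon) (y : 𝒴) :
    StructuredArrow y F ⥤ Under (p.obj y) where
  obj a := Under.mk (p.map a.hom)
  map {a b} h := Under.homMk (p.map (F.map h.right)) (by
    simp only [Under.mk_hom, ← p.map_comp, StructuredArrow.w])
  map_id a := by ext; simp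
  map_comp h k := by ext; simp

/-- The base change of `F` along `y` is represented by the subfunctor of `Hom(p y, -)` given by the
homomorphisms in `S`. -/
structure IsRepresentedBy {𝒳 : Type*} {𝒴 : Type*} [Category 𝒳] [Category 𝒴] (F : 𝒳 ⥤ 𝒴) (p : 𝒴 ⥤ Mon)
    (y : 𝒴) (S : ∀ P : Mon, ((p.obj y).obj.carrier →+ P.obj.carrier) → Prop) : Prop where
  full : (baseChange F p y).Full
  faithful : (baseChange F p y).Faithful
  mem_iff : ∀ g : Under (p.obj y),
    (baseChange F p y).essImage g ↔ S g.right (SharpMon.hom g.hom.hom)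

/-- A map of cone stacks is a subdivision if its base change to every cone `σ = M^∨` is a
subdivision `Δ → σ`: it represents the maps of cones `P^∨ → σ` whose image lies in a cone of `Δ`. -/
def IsSubdivision {𝒳 : Type*} {𝒴 : Type*} [Category 𝒳] [Category 𝒴] (F : 𝒳 ⥤ 𝒴) (p : 𝒴 ⥤ Mon) : Prop :=
  ∀ y : 𝒴, ∃ Δ : Set (Set (NReal (p.obj y).obj.carrier)),
    IsSubdivisionOfCone (p.obj y).obj.carrier Δ ∧
    IsRepresentedBy F p y fun P f =>
      ∃ τ ∈ Δ, ∀ ψ ∈ dualCone P.obj.carrier, AddMonoidHom.comp ψ (gpMap f) ∈ τ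

/-- A map of cone stacks is a finite index inclusion if its base change to every cone `(σ, N)`
is the same cone `σ` with a finite index sublattice `N'` of `N`: it represents
the maps of cones `P^∨ → σ` that send the lattice of `P^∨` into `N'`. -/
def IsFiniteIndexInclusion {𝒳 : Type*} {𝒴 : Type*} [Category 𝒳] [Category 𝒴] (F : 𝒳 ⥤ 𝒴) (p : 𝒴 ⥤ Mon) :
    Prop :=
  ∀ y : 𝒴, ∃ N' : AddSubgroup (Lattice (p.obj y).obj.carrier), N'.FiniteIndex ∧
    IsRepresentedBy F p y fun P f => ∀ ψ : Lattice P.obj.carrier, ψ.comp (gpMap f) ∈ N'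

end TropRub

end

namespace TropRub

/-! ### Sharp monoids and their groups -/

section Algebra

variable {M : SharpMon}

/-! Every arrow of `Σ_Div` is cocartesian over the base (`DivObj.hom_ext`, `DivObj.exists_factor`).
Hence the base change of a fully faithful functor stays fully faithful, and each claim comes down to
this: for which `f : M → P` does the pushforward of the given object lie in the essential image?

For `Σ_Ord` the condition is that `f` makes all differences `α v - α w` comparable with `0`. By
duality (`exists_eq_of_of_dualCone`: Farkas' lemma, then saturation) an element of `P^gp` lies in
`P` as soon as it is non-negative on `P^∨`. So the condition says that the dual map sends all of
`P^∨` to one side of each hyperplane `α v = α w`, that is, into a single closed cell of the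
arrangement. The cells inside `M^∨` form the fan (`isSubdivisionOfCone_cell`, `exists_subdivision`).

For `Σ_Rub`, stability forces the vertices of the line to be the values of `α`. Along an edge of
positive slope `s`, the chain then has its vertices exactly where `α` takes such a value. So a
stable lift is unique and compatible with contraction (`IsContraction.pieces`), which makes the
forgetful functor full. A lift exists if and only if these points are integral: `α u - α (src e)`
must be divisible by `s` whenever `α u` lies between the end values of `e` (`StableLift.divisible`,
`minLift`). After pushing forward along `f`, this becomes finitely many congruences modulo slopes on
the pulled back integral functionals, which define a finite index subgroup
(`IsContraction.divisible_iff`). In `ℝ≥0` division by `s` is always possible, so no condition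
remains. -/

theorem of_injective (M : SharpMon) : Function.Injective (of : M.carrier →+ Gp M.carrier) := by
  have : IsCancelAdd M.carrier :=
    { add_left_cancel := fun a b c h => M.integral a b c h
      add_right_cancel := fun a b c h => M.integral a b c (by
        simpa only [add_comm] using h) }
  exact Algebra.GrothendieckAddGroup.of_injective

theorem exists_eq_of_sub {M : Type} [AddCommMonoid M] (x : Gp M) :
    ∃ a b : M, x = of a - of b := by
  induction x using AddLocalization.ind with
  | _ y =>
    obtain ⟨a, b, hb⟩ := y
    refine ⟨a, b, ?_⟩
    rw [eq_sub_iff_add_eq, AddLocalization.mk_eq_addMonoidOf_mk']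
    exact (AddLocalization.addMonoidOf (⊤ : AddSubmonoid M)).mk'_spec a ⟨b, hb⟩

theorem eq_zero_of_of_add_of {a b : M.carrier} (h : of a + of b = 0) : a = 0 :=
  M.sharp a b (of_injective M (by rw [map_add, h, map_zero]))

theorem exists_of_nsmul_eq_of {n : ℕ} (hn : n ≠ 0) {x : Gp M.carrier} {m : M.carrier}
    (h : n • x = of m) : ∃ m' : M.carrier, x = of m' := by
  obtain ⟨a, b, rfl⟩ := exists_eq_of_sub x
  obtain ⟨d, rfl⟩ := M.saturated n a b m hn (of_injective M (by
    simp only [map_add, map_nsmul]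
    rw [← h, nsmul_sub]; abel))
  exact ⟨d, by rw [map_add]; abel⟩

/-- Saturation puts a torsion element and its negative in `M`; sharpness then kills both. This makes
slopes unique and division by a slope unambiguous. -/
instance gp_isAddTorsionFree (M : SharpMon) : IsAddTorsionFree (Gp M.carrier) := by
  refine ⟨fun n hn x y hxy => ?_⟩
  have h0 : n • (x - y) = of (0 : M.carrier) := by
    simp only at hxy; rw [nsmul_sub, hxy, sub_self, map_zero]
  have h1 : n • (y - x) = of (0 : M.carrier) := by
    simp only at hxy; rw [nsmul_sub, hxy, sub_self, map_zero]
  obtain ⟨a, ha⟩ := exists_of_nsmul_eq_of hn h0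
  obtain ⟨b, hb⟩ := exists_of_nsmul_eq_of hn h1
  have : a = 0 := eq_zero_of_of_add_of (b := b) (by rw [← ha, ← hb]; abel)
  rw [this, map_zero] at ha
  exact sub_eq_zero.1 ha

theorem GpLE.trans {M : Type} [AddCommMonoid M] {x y z : Gp M} (h : GpLE x y) (k : GpLE y z) :
    GpLE x z := by
  obtain ⟨a, ha⟩ := h
  obtain ⟨b, hb⟩ := k
  exact ⟨a + b, by rw [map_add, ← ha, ← hb]; abel⟩

theorem GpLE.antisymm {x y : Gp M.carrier} (h : GpLE x y) (k : GpLE y x) : x = y := by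
  obtain ⟨a, ha⟩ := h
  obtain ⟨b, hb⟩ := k
  have : a = 0 := eq_zero_of_of_add_of (b := b) (by rw [← ha, ← hb]; abel)
  rw [this, map_zero] at ha
  exact (sub_eq_zero.1 ha).symm

theorem GpLE.map {M P : Type} [AddCommMonoid M] [AddCommMonoid P] (f : M →+ P) {x y : Gp M}
    (h : GpLE x y) : GpLE (gpMap f x) (gpMap f y) := by
  obtain ⟨a, ha⟩ := h
  exact ⟨f a, by rw [← map_sub, ha, gpMap_of]⟩

/-- Comparison of multiples in a saturated monoid. -/
theorem exists_of_zsmul_eq_of {s : ℤ} (hs : 0 < s) {x : Gp M.carrier} {m : M.carrier}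
    (h : s • x = of m) : ∃ m' : M.carrier, x = of m' := by
  lift s to ℕ using hs.le
  rw [natCast_zsmul] at h
  exact exists_of_nsmul_eq_of (by exact_mod_cast hs.ne') h

theorem zsmul_of_right_cancel {s t : ℤ} {m : M.carrier} (hm : m ≠ 0)
    (h : s • of m = t • of m) : s = t := by
  by_contra hst
  have h0 : (s - t) • of m = (s - t) • (0 : Gp M.carrier) := by
    rw [sub_smul, h, sub_self, smul_zero]
  have := zsmul_right_injective (sub_ne_zero.2 hst) h0
  exact hm (of_injective M (by rw [this, map_zero]))

end Algebra

/-! ### Duality for finitely generated monoids -/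

section Duality

/-- Farkas' lemma over `ℚ`. -/
theorem farkas {V : Type*} [AddCommGroup V] [Module ℚ V] {n : ℕ} (a : Fin n → V) (b : V)
    (h : ∀ φ : V →ₗ[ℚ] ℚ, (∀ i, 0 ≤ φ (a i)) → 0 ≤ φ b) :
    ∃ t : Fin n → ℚ, (∀ i, 0 ≤ t i) ∧ b = ∑ i, t i • a i := by
  induction n generalizing b with
  | zero =>
    refine ⟨0, fun i => i.elim0, ?_⟩
    rw [Finset.univ_eq_empty, Finset.sum_empty, ← Module.forall_dual_apply_eq_zero_iff ℚ b]
    intro φ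
    have h1 := h φ fun i => i.elim0
    have h2 := h (-φ) fun i => i.elim0
    simp only [LinearMap.neg_apply] at h2
    linarith
  | succ n ih =>
    -- Either `a 0` is not needed, or some functional separates `b` from the other generators; by
    -- `h` that functional must be negative on `a 0`.
    by_cases hc : ∀ φ : V →ₗ[ℚ] ℚ, (∀ i, 0 ≤ φ (a (Fin.succ i))) → 0 ≤ φ b
    · obtain ⟨t, ht, hb⟩ := ih _ b hc
      refine ⟨Fin.cons 0 t, fun i => ?_, ?_⟩
      · refine Fin.cases ?_ (fun i => ?_) i
        · simp
        · simpa using ht i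
      · rw [Fin.sum_univ_succ]; simpa using hb
    push Not at hc
    obtain ⟨φ₁, hφ₁, hb₁⟩ := hc
    have h0 : φ₁ (a 0) < 0 := by
      by_contra hn
      exact absurd (h φ₁ (fun i => Fin.cases (not_lt.1 hn) hφ₁ i)) (not_le.2 hb₁)
    obtain ⟨φ₀, hφ₀, hb₀, h00⟩ : ∃ φ₀ : V →ₗ[ℚ] ℚ, (∀ i : Fin n, 0 ≤ φ₀ (a i.succ)) ∧ φ₀ b < 0 ∧
        φ₀ (a 0) = -1 := by
      have hp : 0 < (-φ₁ (a 0))⁻¹ := inv_pos.2 (by linarith)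
      refine ⟨(-φ₁ (a 0))⁻¹ • φ₁, fun i => ?_, ?_, ?_⟩
      · exact mul_nonneg hp.le (hφ₁ i)
      · exact mul_neg_of_pos_of_neg hp hb₁
      · change (-φ₁ (a 0))⁻¹ * φ₁ (a 0) = -1
        rw [inv_neg, neg_mul, inv_mul_cancel₀ h0.ne]
    -- Induction is applied after the projection `x ↦ x + φ₀ x • a 0` onto the kernel of `φ₀`.
    -- Composing `φ` with it gives `φ + φ (a 0) • φ₀`, which vanishes on `a 0`.
    obtain ⟨t, ht, hb⟩ := ih (fun i => a i.succ + φ₀ (a i.succ) • a 0) (b + φ₀ b • a 0)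
      fun φ hφ => by
        have := h (φ + φ (a 0) • φ₀) fun i => by
          refine Fin.cases ?_ (fun i => ?_) i
          · simp [h00]
          · have := hφ i
            simp only [map_add, map_smul, smul_eq_mul, LinearMap.add_apply,
              LinearMap.smul_apply] at this ⊢
            linarith
        simp only [map_add, map_smul, smul_eq_mul, LinearMap.add_apply,
          LinearMap.smul_apply] at this ⊢
        linarith
    -- The coefficient of `a 0` undoes the projection; it is non-negative because `φ₀ b < 0` and `φ₀
    -- ≥ 0` on the other generators.
    refine ⟨Fin.cons ((∑ i, t i * φ₀ (a i.succ)) - φ₀ b) t, fun i => ?_, ?_⟩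
    · refine Fin.cases ?_ (fun i => ?_) i
      · have := Finset.sum_nonneg fun i (_ : i ∈ Finset.univ) => mul_nonneg (ht i) (hφ₀ i)
        simp only [Fin.cons_zero]
        linarith
      · simpa using ht i
    · rw [Fin.sum_univ_succ]
      simp only [Fin.cons_zero, Fin.cons_succ]
      simp only [smul_add, Finset.sum_add_distrib, smul_smul, ← Finset.sum_smul] at hb
      rw [sub_smul, sub_add_eq_add_sub, add_comm (_ • a 0), ← hb, add_sub_cancel_right]

theorem exists_nat_mul_nonneg_rat {n : ℕ} (t : Fin n → ℚ) (ht : ∀ i, 0 ≤ t i) :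
    ∃ (N : ℕ) (k : Fin n → ℕ), N ≠ 0 ∧ ∀ i, (N : ℚ) * t i = k i := by
  refine ⟨∏ i, (t i).den, fun i => (t i).num.toNat * ∏ j ∈ Finset.univ.erase i, (t j).den,
    Finset.prod_ne_zero_iff.2 fun i _ => (t i).den_nz, fun i => ?_⟩
  rw [← Finset.mul_prod_erase _ _ (Finset.mem_univ i)]
  have h1 : (((t i).num.toNat : ℕ) : ℚ) = (t i).num := by
    exact_mod_cast Int.toNat_of_nonneg (Rat.num_nonneg.2 (ht i))
  push_cast
  rw [h1]
  nth_rewrite 2 [← Rat.num_div_den (t i)]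
  have : ((t i).den : ℚ) ≠ 0 := by exact_mod_cast (t i).den_nz
  field_simp

variable (P : Mon)

instance fg_of_mon : AddMonoid.FG P.obj.carrier := P.property

instance gp_finite_of_mon : Module.Finite ℤ (Gp P.obj.carrier) := inferInstance

instance gp_free_of_mon : Module.Free ℤ (Gp P.obj.carrier) := inferInstance

variable {P}

/-- An element of `P^gp` that is non-negative on the dual cone lies in `P`. -/
theorem exists_eq_of_of_dualCone {x : Gp P.obj.carrier}
    (h : ∀ ψ ∈ dualCone P.obj.carrier, 0 ≤ ψ x) : ∃ m : P.obj.carrier, x = of m := by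
  obtain ⟨S, hS⟩ := (fg_of_mon P).fg_top
  let b := Module.Free.chooseBasis ℤ (Gp P.obj.carrier)
  let j : Gp P.obj.carrier →+ (Module.Free.ChooseBasisIndex ℤ (Gp P.obj.carrier) → ℚ) :=
    { toFun := fun x i => b.repr x i
      map_zero' := by ext; simp
      map_add' := fun x y => by ext; simp }
  have hj : Function.Injective j := fun x y hxy => b.repr.injective (by
    ext i; exact Int.cast_injective (α := ℚ) (congrFun hxy i))
  let e := S.equivFin.symm
  -- A rational functional that is non-negative on the generators is a point of the real dual cone,
  -- so `h` applies to it.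
  obtain ⟨t, ht, hx⟩ := farkas (fun i => j (of (e i : P.obj.carrier))) (j x) fun φ hφ => by
    have := h ((Rat.castHom ℝ).toAddMonoidHom.comp (φ.toAddMonoidHom.comp j)) fun m => by
      have hm : m ∈ AddSubmonoid.closure (S : Set P.obj.carrier) := by rw [hS]; trivial
      induction hm using AddSubmonoid.closure_induction with
      | mem m hm =>
        have := hφ (e.symm ⟨m, hm⟩)
        simpa using this
      | zero => simp
      | add a c _ _ ha hc => rw [map_add, map_add]; exact add_nonneg ha hc
    simpa using this
  obtain ⟨N, k, hN, hk⟩ := exists_nat_mul_nonneg_rat t ht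
  -- With denominators cleared, a multiple of `x` lies in `P`; saturation removes the multiple.
  refine exists_of_nsmul_eq_of (m := ∑ i, k i • (e i : P.obj.carrier)) hN (hj ?_)
  rw [map_nsmul, hx, map_sum, map_sum, Finset.smul_sum]
  refine Finset.sum_congr rfl fun i _ => ?_
  rw [map_nsmul, map_nsmul, ← Nat.cast_smul_eq_nsmul ℚ N, smul_smul, hk, Nat.cast_smul_eq_nsmul]

/-- Divisibility in `P^gp` is detected by the lattice `Hom(P^gp, ℤ)`. -/
theorem exists_zsmul_eq_of_lattice {s : ℤ} {x : Gp P.obj.carrier}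
    (h : ∀ ψ : Lattice P.obj.carrier, s ∣ ψ x) : ∃ z, x = s • z := by
  let b := Module.Free.chooseBasis ℤ (Gp P.obj.carrier)
  choose k hk using fun i => h (b.coord i).toAddMonoidHom
  refine ⟨∑ i, k i • b i, ?_⟩
  rw [Finset.smul_sum]
  conv_lhs => rw [← b.sum_repr x]
  refine Finset.sum_congr rfl fun i _ => ?_
  rw [smul_smul, ← hk]; rfl

end Duality

/-! ### The fan of a finite symmetric set of hyperplanes -/

section Fan

variable {M : Type} [AddCommMonoid M]

/-- The closed cell containing `φ₀` in its relative interior, of the arrangement of the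
half-spaces given by `S`. -/
def cell (S : Finset (Gp M)) (φ₀ : NReal M) : Set (NReal M) :=
  {φ | ∀ s ∈ S, 0 ≤ φ₀ s → 0 ≤ φ s}

theorem mem_cell_self (S : Finset (Gp M)) (φ₀ : NReal M) : φ₀ ∈ cell S φ₀ := fun _ _ h => h

/-- A finite sum of non-negative functionals of a convex cone `F` that is positive on every element
of `S` on which it can be. -/
theorem exists_relint (S : Finset (Gp M)) (F : Set (NReal M)) (h0 : (0 : NReal M) ∈ F)
    (hadd : ∀ φ ∈ F, ∀ ψ ∈ F, φ + ψ ∈ F) :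
    ∃ φ₁ ∈ F, ∀ s ∈ S, (∀ φ ∈ F, 0 ≤ φ s) → φ₁ s = 0 → ∀ φ ∈ F, φ s = 0 := by
  classical
  induction S using Finset.induction_on with
  | empty => exact ⟨0, h0, by simp⟩
  | insert a S _ ih =>
    obtain ⟨φ₁, h₁, hS⟩ := ih
    by_cases ha : ∃ φ ∈ F, φ a ≠ 0
    · obtain ⟨φ₂, h₂, h₂a⟩ := ha
      -- A sum of two non-negative values vanishes only if both do, so adding `φ₂` handles `a`
      -- without losing what `φ₁` achieved.
      refine ⟨φ₁ + φ₂, hadd _ h₁ _ h₂, fun s hs hp h φ hφ => ?_⟩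
      rw [AddMonoidHom.add_apply] at h
      have hp₁ := hp _ h₁
      have hp₂ := hp _ h₂
      rcases Finset.mem_insert.1 hs with rfl | hs
      · exact absurd (by linarith) h₂a
      · exact hS s hs hp (by linarith) φ hφ
    · push Not at ha
      refine ⟨φ₁, h₁, fun s hs hp h φ hφ => ?_⟩
      rcases Finset.mem_insert.1 hs with rfl | hs
      · exact ha φ hφ
      · exact hS s hs hp h φ hφ

/-- A small multiple of a functional can be subtracted from a point of the relative interior. -/
theorem exists_small {S : Finset (Gp M)} {φ₁ φ : NReal M} (h : ∀ s ∈ S, 0 ≤ φ₁ s → φ₁ s = 0 → φ s = 0) :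
    ∃ n : ℕ, 0 < n ∧ ∀ s ∈ S, 0 ≤ φ₁ s → 0 ≤ (n • φ₁ - φ) s := by
  classical
  induction S using Finset.induction_on with
  | empty => exact ⟨1, one_pos, by simp⟩
  | insert a S _ ih =>
    obtain ⟨n, hn, hS⟩ := ih fun s hs => h s (Finset.mem_insert_of_mem hs)
    obtain ⟨k, hk⟩ : ∃ k : ℕ, 0 ≤ φ₁ a → φ a ≤ k * φ₁ a := by
      by_cases ha : 0 < φ₁ a
      · obtain ⟨k, hk⟩ := exists_nat_ge (φ a / φ₁ a)
        exact ⟨k, fun _ => (div_le_iff₀ ha).1 hk⟩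
      · refine ⟨0, fun h1 => ?_⟩
        have h2 : φ₁ a = 0 := le_antisymm (not_lt.1 ha) h1
        simp [h a (Finset.mem_insert_self _ _) h1 h2]
    refine ⟨n + k, by omega, fun s hs hp => ?_⟩
    have hn0 : (0 : ℝ) ≤ n := n.cast_nonneg
    have hk0 : (0 : ℝ) ≤ k := k.cast_nonneg
    rcases Finset.mem_insert.1 hs with rfl | hs
    · have := hk hp
      have := mul_nonneg hn0 hp
      simp only [AddMonoidHom.sub_apply, AddMonoidHom.nsmul_apply, nsmul_eq_mul, Nat.cast_add]
      linarith
    · have := hS s hs hp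
      have := mul_nonneg hk0 hp
      simp only [AddMonoidHom.sub_apply, AddMonoidHom.nsmul_apply, nsmul_eq_mul,
        Nat.cast_add] at *
      linarith

/-- The face is the cell of any point `φ₁` in its relative interior. If `φ₁ s ≥ 0 > φ₀ s`, then `-s`
is non-negative on the cell, so `s` vanishes at `φ₁` and hence on the whole face. Conversely, for
`φ` in the cell of `φ₁`, a large multiple of `φ₁` minus `φ` stays in the cell of `φ₀`, which forces
`φ x ≤ 0`. -/
theorem face_cell {S : Finset (Gp M)} (hS : ∀ s ∈ S, -s ∈ S) (φ₀ : NReal M) {ρ : Set (NReal M)}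
    (hρ : IsFace ρ (cell S φ₀)) : ∃ φ₁ ∈ cell S φ₀, ρ = cell S φ₁ := by
  obtain ⟨x, hx, rfl⟩ := hρ
  obtain ⟨φ₁, h₁, hrel⟩ := exists_relint S {φ ∈ cell S φ₀ | φ x = 0}
    ⟨fun s _ _ => by simp, by simp⟩ fun φ hφ ψ hψ => ⟨fun s hs h =>
      add_nonneg (hφ.1 s hs h) (hψ.1 s hs h), by simp [hφ.2, hψ.2]⟩
  refine ⟨φ₁, h₁.1, Set.Subset.antisymm (fun φ hφ s hs h => ?_) fun φ hφ => ?_⟩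
  · by_cases h0 : 0 ≤ φ₀ s
    · exact hφ.1 s hs h0
    · have hneg : 0 ≤ φ₀ (-s) := by rw [map_neg]; linarith
      have h1 := h₁.1 _ (hS s hs) hneg
      rw [map_neg] at h1
      have := hrel (-s) (hS s hs) (fun ψ hψ => hψ.1 _ (hS s hs) hneg)
        (by rw [map_neg]; linarith) φ hφ
      rw [map_neg] at this
      linarith
  · have hφ₀ : φ ∈ cell S φ₀ := fun s hs h => hφ s hs (h₁.1 s hs h)
    refine ⟨hφ₀, ?_⟩
    obtain ⟨n, _, hn⟩ := exists_small (S := S) (φ₁ := φ₁) (φ := φ) fun s hs _ h0 => by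
      have h1 := hφ s hs h0.ge
      have h2 := hφ (-s) (hS s hs) (by rw [map_neg, h0, neg_zero])
      rw [map_neg] at h2
      linarith
    have h1 := hx (n • φ₁ - φ) fun s hs h => hn s hs (h₁.1 s hs h)
    have h2 := hx φ hφ₀
    simp only [AddMonoidHom.sub_apply, AddMonoidHom.nsmul_apply, h₁.2] at h1
    simp only [smul_zero, zero_sub] at h1
    linarith

/-- The supporting functional is the sum of all `s` with `φ₁ s ≤ 0 ≤ φ₀ s`. Each term is
non-negative on the first cell, so the sum vanishes exactly where every term does, and these
equations single out the second cell. -/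
theorem inter_cell {S : Finset (Gp M)} (hS : ∀ s ∈ S, -s ∈ S) (φ₀ φ₁ : NReal M) :
    IsFace (cell S φ₀ ∩ cell S φ₁) (cell S φ₀) := by
  classical
  let T := S.filter fun s => 0 ≤ φ₀ s ∧ φ₁ s ≤ 0
  have hT : ∀ φ ∈ cell S φ₀, ∀ s ∈ T, 0 ≤ φ s := fun φ hφ s hs =>
    hφ s (Finset.mem_filter.1 hs).1 (Finset.mem_filter.1 hs).2.1
  refine ⟨∑ s ∈ T, s, fun φ hφ => ?_, ?_⟩
  · rw [map_sum]
    exact Finset.sum_nonneg (hT φ hφ)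
  ext φ
  refine and_congr_right fun hφ => ?_
  rw [map_sum, Finset.sum_eq_zero_iff_of_nonneg (hT φ hφ)]
  constructor
  · intro h s hs
    obtain ⟨hs, h0, h1⟩ := Finset.mem_filter.1 hs
    have h2 := h (-s) (hS s hs) (by rw [map_neg]; linarith)
    have h3 := hφ s hs h0
    rw [map_neg] at h2
    linarith
  · intro h s hs h1
    by_cases h0 : 0 ≤ φ₀ s
    · exact hφ s hs h0
    · have := h (-s) (Finset.mem_filter.2 ⟨hS s hs, by rw [map_neg]; linarith,
        by rw [map_neg]; linarith⟩)
      rw [map_neg] at this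
      linarith

/-- The cells that meet the dual cone form a subdivision of it, if `S` contains generators. -/
theorem isSubdivisionOfCone_cell {S : Finset (Gp M)} (hS : ∀ s ∈ S, -s ∈ S)
    (hgen : ∀ φ : NReal M, φ ∈ dualCone M ↔ ∀ s ∈ S, (∃ m, s = of m) → 0 ≤ φ s) :
    IsSubdivisionOfCone M (cell S '' dualCone M) := by
  classical
  have hsub : ∀ φ₀ ∈ dualCone M, cell S φ₀ ⊆ dualCone M := fun φ₀ h₀ φ hφ =>
    (hgen φ).2 fun s hs ⟨m, hm⟩ => hφ s hs (hm ▸ h₀ m)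
  refine ⟨?_, ?_, ?_, ?_, ?_, ?_⟩
  · refine ((S.powerset.finite_toSet.image fun T => {φ : NReal M | ∀ s ∈ T, 0 ≤ φ s})).subset ?_
    rintro _ ⟨φ₀, -, rfl⟩
    refine ⟨S.filter fun s => 0 ≤ φ₀ s, Finset.mem_coe.2 (Finset.mem_powerset.2 (Finset.filter_subset _ _)), ?_⟩
    ext φ
    simp [cell]
  · rintro _ ⟨φ₀, -, rfl⟩
    refine ⟨S.filter fun s => 0 ≤ φ₀ s, ?_⟩
    ext φ
    simp [cell]
  · rintro _ ⟨φ₀, h₀, rfl⟩ φ hφ hneg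
    refine gp_hom_ext fun m => ?_
    have h1 := hsub φ₀ h₀ hφ m
    have h2 := hsub φ₀ h₀ hneg m
    rw [AddMonoidHom.neg_apply] at h2
    rw [AddMonoidHom.zero_apply]
    linarith
  · rintro _ ⟨φ₀, h₀, rfl⟩ ρ hρ
    obtain ⟨φ₁, h₁, rfl⟩ := face_cell hS φ₀ hρ
    exact ⟨φ₁, hsub φ₀ h₀ h₁, rfl⟩
  · rintro _ ⟨φ₀, -, rfl⟩ _ ⟨φ₁, -, rfl⟩
    refine ⟨inter_cell hS φ₀ φ₁, ?_⟩
    rw [Set.inter_comm]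
    exact inter_cell hS φ₁ φ₀
  · refine Set.Subset.antisymm ?_ fun φ hφ => ⟨_, ⟨φ, hφ, rfl⟩, mem_cell_self S φ⟩
    rintro φ ⟨_, ⟨φ₀, h₀, rfl⟩, hφ⟩
    exact hsub φ₀ h₀ hφ

end Fan

/-- Differences of values of a function and their comparability after a map `f : M → P` are
controlled by a subdivision of the dual cone of `M`. -/
theorem exists_subdivision (M : Mon) (D : Set (Gp M.obj.carrier)) (hD : D.Finite)
    (hneg : ∀ d ∈ D, -d ∈ D) :
    ∃ Δ, IsSubdivisionOfCone M.obj.carrier Δ ∧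
      ∀ (P : Mon) (f : M.obj.carrier →+ P.obj.carrier),
        (∃ τ ∈ Δ, ∀ ψ ∈ dualCone P.obj.carrier, AddMonoidHom.comp ψ (gpMap f) ∈ τ) ↔
          ∀ d ∈ D, GpLE 0 (gpMap f d) ∨ GpLE (gpMap f d) 0 := by
  classical
  obtain ⟨G, hG⟩ := (fg_of_mon M).fg_top
  let S : Finset (Gp M.obj.carrier) :=
    G.image (fun g => of g) ∪ G.image (fun g => -of g) ∪ hD.toFinset
  have mem_S : ∀ s, s ∈ S ↔ (∃ g ∈ G, of g = s) ∨ (∃ g ∈ G, -of g = s) ∨ s ∈ D := fun s => by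
    simp [S]
  have hS : ∀ s ∈ S, -s ∈ S := fun s hs => by
    rw [mem_S] at hs ⊢
    rcases hs with ⟨g, hg, rfl⟩ | ⟨g, hg, rfl⟩ | hs
    · exact Or.inr (Or.inl ⟨g, hg, rfl⟩)
    · exact Or.inl ⟨g, hg, by rw [neg_neg]⟩
    · exact Or.inr (Or.inr (hneg _ hs))
  have hgen : ∀ φ : NReal M.obj.carrier, φ ∈ dualCone M.obj.carrier ↔
      ∀ s ∈ S, (∃ m, s = of m) → 0 ≤ φ s := fun φ => by
    refine ⟨fun h s _ ⟨m, hm⟩ => hm ▸ h m, fun h m => ?_⟩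
    have hm : m ∈ AddSubmonoid.closure (G : Set M.obj.carrier) := by rw [hG]; trivial
    induction hm using AddSubmonoid.closure_induction with
    | mem m hm => exact h _ ((mem_S _).2 (Or.inl ⟨m, hm, rfl⟩)) ⟨m, rfl⟩
    | zero => simp
    | add a c _ _ ha hc => rw [map_add, map_add]; exact add_nonneg ha hc
  refine ⟨_, isSubdivisionOfCone_cell hS hgen, fun P f => ?_⟩
  have hcomp : ∀ ψ ∈ dualCone P.obj.carrier, ψ.comp (gpMap f) ∈ dualCone M.obj.carrier :=
    fun ψ hψ m => by rw [AddMonoidHom.comp_apply, gpMap_of]; exact hψ _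
  have key : ∀ ψ ∈ dualCone P.obj.carrier, ∀ {x}, GpLE 0 x → 0 ≤ ψ x := by
    rintro ψ hψ x ⟨m, hm⟩
    rw [sub_zero] at hm
    exact hm ▸ hψ m
  constructor
  · rintro ⟨_, ⟨φ₀, -, rfl⟩, h⟩ d hd
    -- The sign of `d` at `φ₀` is its sign on the whole cell, hence on the image of `P^∨`; duality
    -- turns this into membership in `P`.
    have nonneg : ∀ d ∈ D, 0 ≤ φ₀ d → GpLE 0 (gpMap f d) := fun d hd h0 => by
      obtain ⟨m, hm⟩ := exists_eq_of_of_dualCone fun ψ hψ =>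
        h ψ hψ d ((mem_S d).2 (Or.inr (Or.inr hd))) h0
      exact ⟨m, by rw [hm, sub_zero]⟩
    rcases le_total 0 (φ₀ d) with h0 | h0
    · exact Or.inl (nonneg d hd h0)
    · obtain ⟨m, hm⟩ := nonneg (-d) (hneg d hd) (by rw [map_neg]; linarith)
      exact Or.inr ⟨m, by rw [← hm, map_neg, sub_zero, zero_sub]⟩
  · intro h
    -- The required cell is that of the pullback of a relatively interior point of `P^∨`. If `s` is
    -- non-negative there but only `-s` is known to map into `P`, then `s` vanishes at `ψ₀`, hence
    -- on all of `P^∨`.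
    obtain ⟨ψ₀, h₀, hrel⟩ := exists_relint (S.image (gpMap f)) (dualCone P.obj.carrier)
      (fun m => by simp) fun φ hφ ψ hψ m => add_nonneg (hφ m) (hψ m)
    refine ⟨_, ⟨_, hcomp ψ₀ h₀, rfl⟩, fun ψ hψ s hs hpos => ?_⟩
    have htot : GpLE 0 (gpMap f s) ∨ GpLE 0 (gpMap f (-s)) := by
      rcases (mem_S s).1 hs with ⟨g, hg, rfl⟩ | ⟨g, hg, rfl⟩ | hs
      · exact Or.inl ⟨f g, by rw [gpMap_of, sub_zero]⟩
      · exact Or.inr ⟨f g, by rw [neg_neg, gpMap_of, sub_zero]⟩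
      · refine (h s hs).imp_right ?_
        rintro ⟨m, hm⟩
        exact ⟨m, by rw [← hm, map_neg, sub_zero, zero_sub]⟩
    rcases htot with h1 | h1
    · exact key ψ hψ h1
    · have h2 := key ψ₀ h₀ h1
      rw [AddMonoidHom.comp_apply] at hpos ⊢
      have := hrel (gpMap f (-s)) (Finset.mem_image_of_mem _ (hS s hs))
        (fun ψ hψ => key ψ hψ h1) (by rw [map_neg, map_neg] at h2 ⊢; linarith) ψ hψ
      rw [map_neg, map_neg] at this
      linarith

/-! ### Contractions -/

section Contraction

variable {M P Q : Type} [AddCommMonoid M] [AddCommMonoid P] [AddCommMonoid Q]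

theorem IsContraction.tgt_edge {f : M →+ P} {C : PLCurve M} {D : PLCurve P} {v : C.V → D.V}
    {ε : D.E → C.E} (h : IsContraction f C D v ε) (e : D.E) : v (C.tgt (ε e)) = D.tgt e := by
  unfold TropCurve.tgt
  rw [← h.edge_rev, h.edge_src]

/-- Contractions are cocartesian. -/
theorem IsContraction.factor {f : M →+ P} {g : P →+ Q} {C : PLCurve M} {D : PLCurve P}
    {F : PLCurve Q} {v₁ : C.V → D.V} {ε₁ : D.E → C.E} {v : C.V → F.V} {ε : F.E → C.E}
    (h : IsContraction f C D v₁ ε₁) (k : IsContraction (g.comp f) C F v ε) :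
    ∃ (v₂ : D.V → F.V) (ε₂ : F.E → D.E), IsContraction g D F v₂ ε₂ ∧ v₂ ∘ v₁ = v ∧
      ε₁ ∘ ε₂ = ε := by
  -- The choice of section is harmless: vertices identified by `f` are joined by edges that `g.comp
  -- f` contracts too.
  obtain ⟨r, hr⟩ := h.vert_surjective.hasRightInverse
  have hv : ∀ x, v (r (v₁ x)) = v x := fun x => by
    refine (k.vert_eq_iff _ _).2 (Relation.ReflTransGen.mono ?_ _ _
      ((h.vert_eq_iff _ _).1 (hr (v₁ x))))
    rintro a b ⟨e, h1, h2, h3⟩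
    exact ⟨e, h1, h2, by rw [AddMonoidHom.comp_apply, h3, map_zero]⟩
  have hε : ∀ e, ∃ e', ε₁ e' = ε e := fun e => by
    refine (h.edge_range _).2 fun h0 => (k.edge_range (ε e)).1 ⟨e, rfl⟩ ?_
    rw [AddMonoidHom.comp_apply, h0, map_zero]
  choose ε₂ hε₂ using hε
  refine ⟨fun x => v (r x), ε₂, ?_, funext hv, funext hε₂⟩
  constructor
  · intro a b hab
    exact k.edge_injective (by rw [← hε₂, ← hε₂, hab])
  · intro e
    rw [h.edge_len, ← AddMonoidHom.comp_apply, ← k.edge_range]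
    refine exists_congr fun e' => ?_
    rw [← hε₂, h.edge_injective.eq_iff]
  · intro e
    apply h.edge_injective
    rw [hε₂, k.edge_rev, h.edge_rev, hε₂]
  · intro e
    rw [← h.edge_src, hv, hε₂, k.edge_src]
  · intro e
    rw [k.edge_len, h.edge_len, hε₂]; rfl
  · intro y
    obtain ⟨x, rfl⟩ := k.vert_surjective y
    exact ⟨v₁ x, hv x⟩
  · intro a b
    constructor
    · intro hab
      have hpath := (k.vert_eq_iff (r a) (r b)).1 hab
      rw [← hr a, ← hr b]
      generalize r b = y at hpath
      induction hpath with
      | refl => exact .refl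
      | tail _ hs ih =>
        obtain ⟨e, rfl, rfl, h0⟩ := hs
        by_cases hf : f (C.len e) = 0
        · rwa [← (h.vert_eq_iff _ _).2 (.single ⟨e, rfl, rfl, hf⟩)]
        · obtain ⟨e', rfl⟩ := (h.edge_range e).2 hf
          refine ih.tail ⟨e', (h.edge_src e').symm, (h.tgt_edge e').symm, ?_⟩
          rw [h.edge_len]; exact h0
    · intro hab
      induction hab with
      | refl => rfl
      | tail _ hs ih =>
        obtain ⟨e, rfl, rfl, h0⟩ := hs
        rw [ih, ← h.edge_src, ← h.tgt_edge, hv, hv]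
        refine (k.vert_eq_iff _ _).2 (.single ⟨ε₁ e, rfl, rfl, ?_⟩)
        rw [AddMonoidHom.comp_apply, ← h.edge_len, h0]
  · rw [k.legs, h.legs, List.map_map]
    exact congrArg (fun w => C.legs.map w) (funext fun x => (hv x).symm)
  · intro x
    obtain ⟨y, rfl⟩ := h.vert_surjective x
    simp only [hv]
    rw [k.α, h.α, gpMap_comp]; rfl

/-- Two vertices are identified if they are joined by a path of edges of length zero. -/
def contractSetoid (f : M →+ P) (C : TropCurve M) : Setoid C.V where
  r := Relation.ReflTransGen fun a b => ∃ e, C.src e = a ∧ C.tgt e = b ∧ f (C.len e) = 0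
  iseqv :=
    { refl := fun _ => .refl
      symm := fun {a b} h => by
        refine (@Relation.ReflTransGen.stdSymm _ _ ⟨?_⟩).symm _ _ h
        rintro _ _ ⟨e, rfl, rfl, h0⟩
        exact ⟨C.rev e, rfl, by unfold TropCurve.tgt; rw [C.rev_rev], by rw [C.len_rev, h0]⟩
      trans := fun {_ _ _} h k => h.trans k }

theorem alpha_eq_of_contracted (f : M →+ P) (C : PLCurve M) {v w : C.V}
    (h : contractSetoid f C.toTropCurve v w) : gpMap f (C.α v) = gpMap f (C.α w) := by
  induction h with
  | refl => rfl
  | tail _ hs ih =>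
    obtain ⟨e, rfl, rfl, h0⟩ := hs
    obtain ⟨s, hs⟩ := C.isPL e
    rw [ih, eq_comm, ← sub_eq_zero, ← map_sub, hs, map_zsmul, gpMap_of, h0, map_zero, smul_zero]

/-- The curve obtained by changing the lengths and the function along `f`, and contracting the
edges whose length becomes `0`. -/
noncomputable def pushforward (f : M →+ P) (C : PLCurve M) : PLCurve P where
  V := Quotient (contractSetoid f C.toTropCurve)
  E := {e : C.E // f (C.len e) ≠ 0}
  finite_V := haveI := C.finite_V; inferInstance
  finite_E := haveI := C.finite_E; inferInstance
  src e := Quotient.mk _ (C.src e.1)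
  rev e := ⟨C.rev e.1, by rw [C.len_rev]; exact e.2⟩
  rev_rev e := Subtype.ext (C.rev_rev e.1)
  rev_ne e h := C.rev_ne e.1 (congrArg Subtype.val h)
  len e := f (C.len e.1)
  len_rev e := by rw [C.len_rev]
  len_ne_zero e := e.2
  legs := C.legs.map (Quotient.mk _)
  legs_ne_nil := by simpa using C.legs_ne_nil
  connected := by
    intro v w
    induction v using Quotient.ind with | _ v => ?_
    induction w using Quotient.ind with | _ w => ?_
    induction C.connected v w with
    | refl => exact .refl
    | tail _ hs ih =>
      obtain ⟨e, rfl, rfl⟩ := hs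
      by_cases h0 : f (C.len e) = 0
      · have : Quotient.mk (contractSetoid f C.toTropCurve) (C.src e) = Quotient.mk _ (C.src (C.rev e)) :=
          Quotient.sound (.single ⟨e, rfl, rfl, h0⟩)
        rwa [← this]
      · exact ih.tail ⟨⟨e, h0⟩, rfl, rfl⟩
  α := Quotient.lift (fun v => gpMap f (C.α v)) fun _ _ h => alpha_eq_of_contracted f C h
  isPL e := by
    obtain ⟨s, hs⟩ := C.isPL e.1
    refine ⟨s, ?_⟩
    change gpMap f (C.α (C.tgt e.1)) - gpMap f (C.α (C.src e.1)) = _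
    rw [← map_sub, hs, map_zsmul, gpMap_of]
  α_leg := by
    rw [List.head_map]
    change gpMap f (C.α _) = 0
    rw [C.α_leg, map_zero]

theorem isContraction_pushforward (f : M →+ P) (C : PLCurve M) :
    IsContraction f C (pushforward f C) (Quotient.mk _) Subtype.val where
  edge_injective := Subtype.val_injective
  edge_range e := ⟨fun ⟨e', h⟩ => h ▸ e'.2, fun h => ⟨⟨e, h⟩, rfl⟩⟩
  edge_rev _ := rfl
  edge_src _ := rfl
  edge_len _ := rfl
  vert_surjective := Quotient.mk_surjective
  vert_eq_iff _ _ := Quotient.eq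
  legs := rfl
  α _ := rfl

end Contraction

/-! ### The category `Σ_Div` is cofibred over the base -/

section Cofibred

universe u v

variable {B : Type u} [Category.{v} B] {U : B ⥤ SharpMon}

/-- An arrow is surjective on vertices and, in the opposite direction, injective on edges, so it can
be cancelled. This is the uniqueness half of being cocartesian. -/
theorem DivObj.hom_ext {X Y Z : DivObj U} (h : X ⟶ Y) {m m' : Y ⟶ Z}
    (hb : (divBase U).map m = (divBase U).map m') (hm : h ≫ m = h ≫ m') : m = m' := by
  refine DivHom.ext hb (funext fun x => ?_) (funext fun e => ?_)
  · obtain ⟨y, rfl⟩ := DivHom.isContraction h |>.vert_surjective x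
    exact congrFun (congrArg DivHom.vert hm) y
  · exact (DivHom.isContraction h).edge_injective (congrFun (congrArg DivHom.edge hm) e)

theorem DivObj.exists_factor {X Y Z : DivObj U} (h : X ⟶ Y) (k : X ⟶ Z) (g : Y.base ⟶ Z.base)
    (hg : (divBase U).map h ≫ g = (divBase U).map k) :
    ∃ m : Y ⟶ Z, (divBase U).map m = g ∧ h ≫ m = k := by
  obtain ⟨kb, kv, ke, kc⟩ := k
  obtain rfl : DivHom.base h ≫ g = kb := hg
  have kc' := kc
  rw [U.map_comp, SharpMon.hom_comp] at kc'
  obtain ⟨v, ε, hc, hv, hε⟩ := (DivHom.isContraction h).factor kc'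
  exact ⟨⟨g, v, ε, hc⟩, rfl, DivHom.ext rfl hv hε⟩

/-- The arrow from an object of `Σ_Div` to its pushforward. -/
noncomputable def DivObj.push (X : DivObj U) {b : B} (g : X.base ⟶ b) :
    X ⟶ (⟨b, pushforward (SharpMon.hom (U.map g)) X.curve⟩ : DivObj U) :=
  ⟨g, _, _, isContraction_pushforward _ _⟩

end Cofibred

/-- The base change of a fully faithful functor to a category over **Mon** all of whose arrows are
cocartesian is fully faithful. -/
theorem baseChange_fullyFaithful {𝒳 : Type*} {𝒴 : Type*} [Category 𝒳] [Category 𝒴] (F : 𝒳 ⥤ 𝒴)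
    [F.Full] [F.Faithful] (p : 𝒴 ⥤ Mon) (y : 𝒴)
    (ext : ∀ {a b : 𝒴} (h : y ⟶ a) {m m' : a ⟶ b}, p.map m = p.map m' → h ≫ m = h ≫ m' → m = m')
    (factor : ∀ {a b : 𝒴} (h : y ⟶ a) (k : y ⟶ b) (g : p.obj a ⟶ p.obj b),
      p.map h ≫ g = p.map k → ∃ m : a ⟶ b, p.map m = g ∧ h ≫ m = k) :
    (baseChange F p y).Full ∧ (baseChange F p y).Faithful := by
  constructor
  · refine ⟨fun {a b} g => ?_⟩
    obtain ⟨m, hm, hk⟩ := factor a.hom b.hom g.right (Under.w g)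
    refine ⟨StructuredArrow.homMk (F.preimage m) (by rw [F.map_preimage, hk]), ?_⟩
    ext1
    change p.map (F.map (F.preimage m)) = g.right
    rw [F.map_preimage, hm]
  · refine ⟨fun {a b} g g' h => ?_⟩
    have h1 : p.map (F.map g.right) = p.map (F.map g'.right) := congrArg CommaMorphism.right h
    ext1
    exact F.map_injective (ext a.hom h1 (by rw [StructuredArrow.w, StructuredArrow.w]))

/-! ### Lists of lengths and their partial sums -/

section PartialSums

/-- The set of partial sums of a list. -/
def partialSums {M : Type} [AddCommMonoid M] (l : List M) : Set M :=
  {x | ∃ j ≤ l.length, (l.take j).sum = x}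

section

variable {M P : Type} [AddCommMonoid M] [AddCommMonoid P]

theorem partialSums_nil : partialSums ([] : List M) = {0} := by
  ext x
  simp [partialSums, eq_comm]

theorem zero_mem_partialSums (l : List M) : 0 ∈ partialSums l := ⟨0, by simp, by simp⟩

theorem sum_mem_partialSums (l : List M) : l.sum ∈ partialSums l := ⟨l.length, le_rfl, by simp⟩

theorem partialSums_cons (a : M) (l : List M) :
    partialSums (a :: l) = insert 0 ((a + ·) '' partialSums l) := by
  ext x
  constructor
  · rintro ⟨_ | j, hj, rfl⟩
    · exact Or.inl (by simp)
    · exact Or.inr ⟨_, ⟨j, by simpa using hj, rfl⟩, by simp⟩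
  · rintro (rfl | ⟨_, ⟨j, hj, rfl⟩, rfl⟩)
    · exact zero_mem_partialSums _
    · exact ⟨j + 1, by simpa using hj, by simp⟩

/-- A dropped zero length only repeats a partial sum, so the set of partial sums is simply mapped by
`f`. This is why subdivisions are compared through these sets rather than through lists. -/
theorem partialSums_pushPieces (f : M →+ P) (l : List M) :
    partialSums (pushPieces f l) = f '' partialSums l := by
  classical
  induction l with
  | nil => simp [pushPieces, partialSums_nil]
  | cons a l ih =>
    have himg : f '' partialSums (a :: l) = insert 0 ((f a + ·) '' (f '' partialSums l)) := by
      rw [partialSums_cons, Set.image_insert_eq, map_zero, Set.image_image, Set.image_image]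
      simp
    rw [himg, ← ih]
    by_cases ha : f a = 0
    · have : pushPieces f (a :: l) = pushPieces f l := by simp [pushPieces, ha]
      rw [this, ha]
      simp only [zero_add, Set.image_id']
      exact (Set.insert_eq_of_mem (zero_mem_partialSums _)).symm
    · have : pushPieces f (a :: l) = f a :: pushPieces f l := by simp [pushPieces, ha]
      rw [this, partialSums_cons]

theorem pushPieces_reverse (f : M →+ P) (l : List M) :
    pushPieces f l.reverse = (pushPieces f l).reverse := by
  simp [pushPieces, List.map_reverse, List.filter_reverse]

theorem exists_add_of_mem_partialSums {l : List M} {x : M} (h : x ∈ partialSums l) :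
    ∃ y, x + y = l.sum := by
  obtain ⟨j, -, rfl⟩ := h
  exact ⟨(l.drop j).sum, by rw [← List.sum_append, List.take_append_drop]⟩

theorem sum_take_add (l : List M) {j k : ℕ} (h : j ≤ k) :
    ∃ y, (l.take j).sum + y = (l.take k).sum := by
  refine ⟨((l.take k).drop j).sum, ?_⟩
  rw [← List.sum_append]
  conv_lhs => rw [← min_eq_left h, ← List.take_take, min_eq_left h, List.take_append_drop]

theorem sum_take_add_sum_take_reverse (l : List M) {j k : ℕ} (h : j + k = l.length) :
    (l.take j).sum + (l.reverse.take k).sum = l.sum := by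
  rw [List.take_reverse, List.sum_reverse, ← List.sum_append,
    show l.length - k = j by omega, List.take_append_drop]

end

variable {M : SharpMon}

theorem eq_of_add_eq_of_add_eq {a b c d : M.carrier} (h : a + c = b) (k : b + d = a) : a = b := by
  have : c = 0 := M.sharp c d (M.integral a _ _ (by rw [← add_assoc, h, k, add_zero]))
  rw [← h, this, add_zero]

/-- A list of non-zero elements is determined by its partial sums. -/
theorem eq_of_partialSums_eq {l₁ l₂ : List M.carrier} (h₁ : ∀ m ∈ l₁, m ≠ 0)
    (h₂ : ∀ m ∈ l₂, m ≠ 0) (h : partialSums l₁ = partialSums l₂) : l₁ = l₂ := by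
  induction l₁ generalizing l₂ with
  | nil =>
    cases l₂ with
    | nil => rfl
    | cons b t =>
      have : b ∈ partialSums (b :: t) := ⟨1, by simp, by simp⟩
      rw [← h, partialSums_nil] at this
      exact absurd this (h₂ b (by simp))
  | cons a s ih =>
    have mem : ∀ (b : M.carrier) t, b ∈ partialSums (b :: t) := fun b t => ⟨1, by simp, by simp⟩
    cases l₂ with
    | nil =>
      have := mem a s
      rw [h, partialSums_nil] at this
      exact absurd this (h₁ a (by simp))
    | cons b t =>
      have ha := mem a s
      have hb := mem b t
      rw [h, partialSums_cons] at ha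
      rw [← h, partialSums_cons] at hb
      obtain ⟨x, -, hx⟩ := ha.resolve_left (h₁ a (by simp))
      obtain ⟨y, -, hy⟩ := hb.resolve_left (h₂ b (by simp))
      -- Each head is a non-zero partial sum of the other list, so each exceeds the other by an
      -- element of `M`.
      obtain rfl : a = b := eq_of_add_eq_of_add_eq hy hx
      rw [ih (l₂ := t) (fun m hm => h₁ m (by simp [hm])) (fun m hm => h₂ m (by simp [hm]))]
      have hne : ∀ u : List M.carrier, (0 : M.carrier) ∉ (a + ·) '' partialSums u := by
        rintro u ⟨z, -, hz⟩
        exact h₁ a (by simp) (M.sharp a z hz)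
      rw [partialSums_cons, partialSums_cons] at h
      have h' := congrArg (· \ {0}) h
      simp only [Set.insert_sdiff_self_of_notMem (hne _)] at h'
      exact (Set.image_injective.2 fun _ _ => M.integral a _ _) h'

/-- A finite chain in a sharp integral monoid is the set of partial sums of a list. -/
theorem exists_list_of_chain (T : Finset M.carrier) (m : M.carrier) (h0 : 0 ∈ T) (hm : m ∈ T)
    (hle : ∀ x ∈ T, ∃ y, x + y = m)
    (htot : ∀ x ∈ T, ∀ y ∈ T, ∃ d, x + d = y ∨ y + d = x) :
    ∃ l : List M.carrier, (∀ a ∈ l, a ≠ 0) ∧ l.sum = m ∧ partialSums l = T := by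
  classical
  induction hn : T.card generalizing T m with
  | zero => rw [Finset.card_eq_zero] at hn; simp [hn] at h0
  | succ n ih =>
    by_cases hT : ∃ x ∈ T, x ≠ 0
    · obtain ⟨a, ha, ha0, hmin⟩ : ∃ a ∈ T, a ≠ 0 ∧ ∀ x ∈ T, x ≠ 0 → ∃ d, a + d = x := by
        have key : ∀ S : Finset M.carrier, S ⊆ T → S.Nonempty →
            ∃ a ∈ S, ∀ x ∈ S, ∃ d, a + d = x := by
          intro S
          induction S using Finset.induction_on with
          | empty => intro _ h; simp at h
          | insert b S _ ihS =>
            intro hS _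
            rcases S.eq_empty_or_nonempty with rfl | hne
            · exact ⟨b, by simp, fun x hx => ⟨0, by simp at hx; simp [hx]⟩⟩
            obtain ⟨a, ha, hmin⟩ := ihS (fun x hx => hS (Finset.mem_insert_of_mem hx)) hne
            obtain ⟨d, hd | hd⟩ := htot a (hS (Finset.mem_insert_of_mem ha)) b
              (hS (Finset.mem_insert_self _ _))
            · refine ⟨a, Finset.mem_insert_of_mem ha, fun x hx => ?_⟩
              rcases Finset.mem_insert.1 hx with rfl | hx
              exacts [⟨d, hd⟩, hmin x hx]
            · refine ⟨b, Finset.mem_insert_self _ _, fun x hx => ?_⟩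
              rcases Finset.mem_insert.1 hx with rfl | hx
              · exact ⟨0, add_zero _⟩
              · obtain ⟨c, rfl⟩ := hmin x hx
                exact ⟨d + c, by rw [← add_assoc, hd]⟩
        obtain ⟨x, hx, hx0⟩ := hT
        obtain ⟨a, ha, hmin⟩ := key (T.erase 0) (Finset.erase_subset _ _)
          ⟨x, Finset.mem_erase.2 ⟨hx0, hx⟩⟩
        exact ⟨a, Finset.mem_of_mem_erase ha, Finset.ne_of_mem_erase ha, fun x hx h =>
          hmin x (Finset.mem_erase.2 ⟨h, hx⟩)⟩
      have hinj : Function.Injective (a + ·) := fun _ _ => M.integral a _ _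
      let T' := T.preimage (a + ·) hinj.injOn
      have hmem : ∀ x, x ∈ T' ↔ a + x ∈ T := fun x => Finset.mem_preimage
      have himg : T'.image (a + ·) = T.erase 0 := by
        ext x
        rw [Finset.mem_image, Finset.mem_erase]
        constructor
        · rintro ⟨y, hy, rfl⟩
          exact ⟨fun h => ha0 (M.sharp a y h), (hmem y).1 hy⟩
        · rintro ⟨hx0, hx⟩
          obtain ⟨d, rfl⟩ := hmin x hx hx0
          exact ⟨d, (hmem d).2 hx, rfl⟩
      obtain ⟨m', rfl⟩ := hle a ha
      obtain ⟨l, hl, hsum, hps⟩ := ih T' m' ((hmem 0).2 (by rwa [add_zero])) ((hmem m').2 hm)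
        (fun x hx => by
          obtain ⟨y, hy⟩ := hle _ ((hmem x).1 hx)
          exact ⟨y, M.integral a _ _ (by rw [← add_assoc, hy])⟩)
        (fun x hx y hy => by
          obtain ⟨d, hd⟩ := htot _ ((hmem x).1 hx) _ ((hmem y).1 hy)
          refine ⟨d, hd.imp (fun h => M.integral a _ _ ?_) fun h => M.integral a _ _ ?_⟩ <;>
          rw [← add_assoc, h])
        (by
          rw [← Finset.card_image_of_injective T' hinj, himg, Finset.card_erase_of_mem h0, hn]
          rfl)
      refine ⟨a :: l, ?_, by rw [List.sum_cons, hsum], ?_⟩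
      · intro b hb
        rcases List.mem_cons.1 hb with rfl | hb
        exacts [ha0, hl b hb]
      · rw [partialSums_cons, hps, ← Finset.coe_image, himg, ← Finset.coe_insert,
          Finset.insert_erase h0]
    · push Not at hT
      refine ⟨[], by simp, ?_, ?_⟩
      · rw [hT m hm, List.sum_nil]
      · rw [partialSums_nil]
        ext x
        exact ⟨fun h => h ▸ h0, fun h => hT x h⟩

end PartialSums

/-! ### Slopes and lifts -/

section Lifts

theorem PLCurve.slope_spec {M : Type} [AddCommMonoid M] (C : PLCurve M) (e : C.E) :
    C.α (C.tgt e) - C.α (C.src e) = C.slope e • of (C.len e) :=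
  Classical.choose_spec (C.isPL e)

theorem TropCurve.tgt_rev {M : Type} [AddCommMonoid M] (C : TropCurve M) (e : C.E) :
    C.tgt (C.rev e) = C.src e := by
  unfold TropCurve.tgt; rw [C.rev_rev]

variable {M P : SharpMon}

theorem PLCurve.slope_eq {C : PLCurve M.carrier} {e : C.E} {s : ℤ}
    (h : C.α (C.tgt e) - C.α (C.src e) = s • of (C.len e)) : C.slope e = s :=
  zsmul_of_right_cancel (C.len_ne_zero e) (by rw [← C.slope_spec, h])

theorem PLCurve.slope_rev (C : PLCurve M.carrier) (e : C.E) :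
    C.slope (C.rev e) = -C.slope e := by
  refine PLCurve.slope_eq ?_
  rw [C.tgt_rev, C.len_rev, neg_smul, ← C.slope_spec, neg_sub]; rfl

theorem IsContraction.slope {f : M.carrier →+ P.carrier} {C : PLCurve M.carrier}
    {D : PLCurve P.carrier} {v : C.V → D.V} {ε : D.E → C.E} (h : IsContraction f C D v ε)
    (e : D.E) : D.slope e = C.slope (ε e) := by
  refine PLCurve.slope_eq ?_
  rw [← h.tgt_edge, ← h.edge_src, h.α, h.α, ← map_sub, C.slope_spec, map_zsmul, gpMap_of,
    h.edge_len]

namespace Subdivision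

variable {C : PLCurve M.carrier} (S : Subdivision C.toTropCurve) (e : C.E)

theorem val_zero : S.val e 0 = C.α (C.src e) := by simp [Subdivision.val]

theorem val_length : S.val e (S.pieces e).length = C.α (C.tgt e) := by
  rw [Subdivision.val, List.take_length, S.sum_pieces, ← C.slope_spec]; abel

theorem val_rev {j k : ℕ} (h : j + k = (S.pieces e).length) :
    S.val (C.rev e) k = S.val e j := by
  have h1 := S.val_length e
  rw [Subdivision.val, List.take_length, ← sum_take_add_sum_take_reverse _ h, map_add,
    smul_add] at h1
  rw [Subdivision.val, Subdivision.val, S.pieces_rev, C.slope_rev]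
  change C.α (C.tgt e) + _ = _
  rw [← h1, neg_smul]; abel

end Subdivision

/-! ### Uniqueness of stable lifts -/

namespace StableLift

variable {C : PLCurve M.carrier} (L : StableLift C)

theorem line_verts : L.line.verts = Set.range C.α :=
  Set.Subset.antisymm (fun x hx => L.line_stable x hx)
    (Set.range_subset_iff.2 L.vertex_mem)

theorem exists_value {e : C.E} {x : M.carrier} (hx : x ∈ partialSums (L.pieces e)) :
    ∃ u, C.α u = C.α (C.src e) + C.slope e • of x := by
  obtain ⟨j, hj, rfl⟩ := hx
  exact L.line_stable _ (L.chain_mem e j hj)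

/-- Every vertex value on the segment spanned by an edge of positive slope is the value of a vertex
of the chain that replaces this edge. -/
theorem exists_mem_partialSums (e : C.E) {u : C.V} (h₁ : GpLE (C.α (C.src e)) (C.α u))
    (h₂ : GpLE (C.α u) (C.α (C.tgt e))) :
    ∃ x ∈ partialSums (L.pieces e), C.α u = C.α (C.src e) + C.slope e • of x := by
  by_contra! hne
  have hval : ∀ j ≤ (L.pieces e).length, C.α u ≠ L.val e j := fun j hj => hne _ ⟨j, hj, rfl⟩
  -- If `α u` is never hit, walking along the chain keeps it above every chain vertex: passing below
  -- the next one would put it inside a cell, against `edge_cell`. At the far end this contradicts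
  -- `h₂`.
  have key : ∀ j ≤ (L.pieces e).length, GpLE (L.val e j) (C.α u) := by
    intro j
    induction j with
    | zero => intro _; rwa [L.val_zero]
    | succ j ih =>
      intro hj
      refine (L.line.total _ (L.vertex_mem u) _ (L.chain_mem e (j + 1) hj)).resolve_left fun h => ?_
      rcases L.edge_cell e j hj _ (L.vertex_mem u) (ih (by omega)) h with h | h
      exacts [hval _ (by omega) h, hval _ hj h]
  refine hval _ le_rfl (GpLE.antisymm ?_ (key _ le_rfl))
  rwa [L.val_length]

end StableLift

/-- A contraction maps the stable lift of the source to that of the target: it is determined by the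
function. -/
theorem IsContraction.pieces {f : M.carrier →+ P.carrier} {C : PLCurve M.carrier}
    {D : PLCurve P.carrier} {v : C.V → D.V} {ε : D.E → C.E} (h : IsContraction f C D v ε)
    (L : StableLift C) (L' : StableLift D) (e : D.E) :
    L'.pieces e = pushPieces f (L.pieces (ε e)) := by
  -- Negative slopes follow by reversing the edge; for slope `0` neither side is subdivided.
  have pos : ∀ e, 0 < D.slope e → L'.pieces e = pushPieces f (L.pieces (ε e)) := fun e hs => by
    have hs' : 0 < C.slope (ε e) := by rwa [← h.slope]
    refine eq_of_partialSums_eq (L'.pieces_ne_zero e) (fun m hm => ?_)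
      (Set.Subset.antisymm ?_ ?_)
    · simpa using (List.mem_filter.1 hm).2
    · intro x hx
      rw [partialSums_pushPieces]
      obtain ⟨u', hu⟩ := L'.exists_value hx
      obtain ⟨u, rfl⟩ := h.vert_surjective u'
      rw [h.α, ← h.edge_src, h.α, h.slope] at hu
      have hsx : ∀ x', C.α u = C.α (C.src (ε e)) + C.slope (ε e) • of x' → f x' = x := by
        intro x' hx'
        rw [hx', map_add, map_zsmul, gpMap_of, add_right_inj] at hu
        exact of_injective P (zsmul_right_injective hs'.ne' hu)
      obtain ⟨y, hy⟩ := exists_add_of_mem_partialSums hx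
      rw [L'.sum_pieces, h.edge_len] at hy
      have hT := L.totallyOrdered
      -- The value at `u` may lie outside the segment of `ε e` before applying `f`. It then becomes
      -- the value at an end of the edge, so `x` is the image of the full length or of `0`.
      rcases hT (C.src (ε e)) u with h₁ | h₁
      · rcases hT u (C.tgt (ε e)) with h₂ | h₂
        · obtain ⟨x', hx', hu'⟩ := L.exists_mem_partialSums (ε e) h₁ h₂
          exact ⟨x', hx', hsx x' hu'⟩
        · refine ⟨C.len (ε e), L.sum_pieces (ε e) ▸ sum_mem_partialSums _, ?_⟩
          obtain ⟨d, hd⟩ := h₂.map f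
          have ht : gpMap f (C.α (C.tgt (ε e))) =
              gpMap f (C.α (C.src (ε e))) + C.slope (ε e) • of (f (C.len (ε e))) := by
            rw [← gpMap_of, ← map_zsmul, ← C.slope_spec, map_sub]; abel
          rw [hu, ht, ← hy, map_add, smul_add] at hd
          have hd' : C.slope (ε e) • (-of y) = of d := by rw [← hd, smul_neg]; abel
          obtain ⟨z, hz⟩ := exists_of_zsmul_eq_of hs' hd'
          have : y = 0 := eq_zero_of_of_add_of (b := z) (by rw [← hz]; abel)
          rw [← hy, this, add_zero]
      · refine ⟨0, zero_mem_partialSums _, ?_⟩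
        obtain ⟨d, hd⟩ := h₁.map f
        rw [hu] at hd
        have hd' : C.slope (ε e) • (-of x) = of d := by rw [← hd, smul_neg]; abel
        obtain ⟨z, hz⟩ := exists_of_zsmul_eq_of hs' hd'
        rw [map_zero]
        exact (eq_zero_of_of_add_of (b := z) (by rw [← hz]; abel)).symm
    · rw [partialSums_pushPieces]
      rintro _ ⟨x, hx, rfl⟩
      obtain ⟨u, hu⟩ := L.exists_value hx
      obtain ⟨y, hy⟩ := exists_add_of_mem_partialSums hx
      rw [L.sum_pieces] at hy
      have hu' : D.α (v u) = D.α (D.src e) + D.slope e • of (f x) := by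
        rw [h.α, hu, map_add, ← h.edge_src, h.α, map_zsmul, gpMap_of, h.slope]
      have ht : D.α (D.tgt e) = D.α (v u) + D.slope e • of (f y) := by
        rw [hu', add_assoc, ← smul_add, ← map_add, ← map_add, hy, ← h.edge_len, ← D.slope_spec]
        abel
      have hle : ∀ z : P.carrier, ∃ d : P.carrier, D.slope e • of z = of d := fun z =>
        ⟨(D.slope e).toNat • z, by
          rw [map_nsmul, ← natCast_zsmul, Int.toNat_of_nonneg hs.le]⟩
      obtain ⟨x', hx', hux⟩ := L'.exists_mem_partialSums e (u := v u)
        (by obtain ⟨d, hd⟩ := hle (f x); exact ⟨d, by rw [hu', ← hd]; abel⟩)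
        (by obtain ⟨d, hd⟩ := hle (f y); exact ⟨d, by rw [ht, ← hd]; abel⟩)
      rw [hu', add_right_inj] at hux
      rwa [of_injective P (zsmul_right_injective hs.ne' hux)]
  rcases lt_trichotomy (D.slope e) 0 with hs | hs | hs
  · have := pos (D.rev e) (by rw [D.slope_rev]; omega)
    rw [L'.pieces_rev, h.edge_rev, L.pieces_rev, pushPieces_reverse] at this
    exact List.reverse_injective this
  · rw [L'.contracted e hs, L.contracted _ (by rw [← h.slope, hs]), h.edge_len]
    have : f (C.len (ε e)) ≠ 0 := (h.edge_range _).1 ⟨e, rfl⟩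
    simp [pushPieces, this]
  · exact pos e hs

/-! ### Existence of stable lifts under the divisibility condition -/

/-- The values of the function on the segment spanned by an edge of positive slope are integral
points of this segment. -/
def PLCurve.Divisible {M : Type} [AddCommMonoid M] (C : PLCurve M) : Prop :=
  ∀ e, 0 < C.slope e → ∀ u, GpLE (C.α (C.src e)) (C.α u) → GpLE (C.α u) (C.α (C.tgt e)) →
    ∃ z, C.α u - C.α (C.src e) = C.slope e • z

/-- A vertex of the chain sits at a distance in `M` from the source, and the slope multiplies this
distance. The converse is `minLift`. -/
theorem StableLift.divisible {C : PLCurve M.carrier} (L : StableLift C) : C.Divisible :=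
  fun e _ u h₁ h₂ => by
    obtain ⟨x, -, hx⟩ := L.exists_mem_partialSums e h₁ h₂
    exact ⟨of x, by rw [hx]; abel⟩

/-- The positions in `M` of the values of the function along an edge. -/
theorem exists_chain {C : PLCurve M.carrier} (hT : C.TotallyOrdered) (e : C.E)
    (hs : 0 < C.slope e) : ∃ l : List M.carrier, (∀ a ∈ l, a ≠ 0) ∧ l.sum = C.len e ∧
      ∀ x, x ∈ partialSums l ↔ (∃ y, x + y = C.len e) ∧
        C.α (C.src e) + C.slope e • of x ∈ Set.range C.α := by
  have := C.finite_V
  let T : Set M.carrier := {x | (∃ y, x + y = C.len e) ∧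
    C.α (C.src e) + C.slope e • of x ∈ Set.range C.α}
  have hfin : T.Finite := by
    refine Set.Finite.of_finite_image (f := fun x => C.α (C.src e) + C.slope e • of x)
      ((Set.finite_range C.α).subset ?_) ?_
    · rintro _ ⟨x, hx, rfl⟩
      exact hx.2
    · intro x _ y _ hxy
      exact of_injective M (zsmul_right_injective hs.ne' (add_left_cancel hxy))
  obtain ⟨l, h1, h2, h3⟩ := exists_list_of_chain hfin.toFinset (C.len e)
    (hfin.mem_toFinset.2 ⟨⟨_, zero_add _⟩, C.src e, by simp⟩)
    (hfin.mem_toFinset.2 ⟨⟨0, add_zero _⟩, C.tgt e, by rw [← C.slope_spec]; abel⟩)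
    (fun x hx => (hfin.mem_toFinset.1 hx).1)
    -- Positions are compared through their values: saturation allows division by the positive
    -- slope.
    (fun x hx y hy => by
      obtain ⟨-, u, hu⟩ := hfin.mem_toFinset.1 hx
      obtain ⟨-, w, hw⟩ := hfin.mem_toFinset.1 hy
      rcases hT u w with ⟨d, hd⟩ | ⟨d, hd⟩
      · have hd' : C.slope e • (of y - of x) = of d := by rw [← hd, hu, hw, smul_sub]; abel
        obtain ⟨z, hz⟩ := exists_of_zsmul_eq_of hs hd'
        exact ⟨z, Or.inl (of_injective M (by rw [map_add, ← hz]; abel))⟩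
      · have hd' : C.slope e • (of x - of y) = of d := by rw [← hd, hu, hw, smul_sub]; abel
        obtain ⟨z, hz⟩ := exists_of_zsmul_eq_of hs hd'
        exact ⟨z, Or.inr (of_injective M (by rw [map_add, ← hz]; abel))⟩)
  refine ⟨l, h1, h2, fun x => ?_⟩
  rw [h3, hfin.coe_toFinset]; rfl

open Classical in
/-- The lengths of the minimal subdivision. -/
noncomputable def minPieces {C : PLCurve M.carrier} (hT : C.TotallyOrdered) (e : C.E) :
    List M.carrier :=
  -- The chain is chosen in the direction of positive slope only and reversed for the other one, so
  -- that the two orientations agree.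
  if h : 0 < C.slope e then (exists_chain hT e h).choose
  else if h : 0 < C.slope (C.rev e) then ((exists_chain hT (C.rev e) h).choose).reverse
  else [C.len e]

variable {C : PLCurve M.carrier} (hT : C.TotallyOrdered)

theorem minPieces_of_pos {e : C.E} (h : 0 < C.slope e) :
    minPieces hT e = (exists_chain hT e h).choose := dif_pos h

theorem minPieces_of_zero {e : C.E} (h : C.slope e = 0) : minPieces hT e = [C.len e] := by
  rw [minPieces, dif_neg (by omega), dif_neg (by rw [C.slope_rev]; omega)]

theorem minPieces_rev (e : C.E) : minPieces hT (C.rev e) = (minPieces hT e).reverse := by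
  have neg : ∀ e, C.slope e < 0 → minPieces hT e = (minPieces hT (C.rev e)).reverse :=
    fun e h => by
      have h' : 0 < C.slope (C.rev e) := by rw [C.slope_rev]; omega
      rw [minPieces_of_pos hT h', minPieces, dif_neg (by omega), dif_pos h']
  rcases lt_trichotomy (C.slope e) 0 with hs | hs | hs
  · rw [neg e hs, List.reverse_reverse]
  · rw [minPieces_of_zero hT hs, minPieces_of_zero hT (by rw [C.slope_rev, hs, neg_zero]),
      C.len_rev, List.reverse_singleton]
  · rw [neg (C.rev e) (by rw [C.slope_rev]; omega), C.rev_rev]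

/-- The minimal subdivision over which the function becomes equidimensional. -/
noncomputable def minSubdivision : Subdivision C.toTropCurve where
  pieces := minPieces hT
  pieces_ne_zero e m hm := by
    rcases lt_trichotomy (C.slope e) 0 with hs | hs | hs
    · have h' : 0 < C.slope (C.rev e) := by rw [C.slope_rev]; omega
      rw [← List.mem_reverse, ← minPieces_rev, minPieces_of_pos hT h'] at hm
      exact (exists_chain hT _ h').choose_spec.1 m hm
    · rw [minPieces_of_zero hT hs, List.mem_singleton] at hm
      exact hm ▸ C.len_ne_zero e
    · rw [minPieces_of_pos hT hs] at hm
      exact (exists_chain hT _ hs).choose_spec.1 m hm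
  sum_pieces e := by
    rcases lt_trichotomy (C.slope e) 0 with hs | hs | hs
    · have h' : 0 < C.slope (C.rev e) := by rw [C.slope_rev]; omega
      rw [← List.sum_reverse, ← minPieces_rev, minPieces_of_pos hT h',
        (exists_chain hT _ h').choose_spec.2.1, C.len_rev]
    · rw [minPieces_of_zero hT hs, List.sum_singleton]
    · rw [minPieces_of_pos hT hs, (exists_chain hT _ hs).choose_spec.2.1]
  pieces_rev := minPieces_rev hT

theorem mem_partialSums_minSubdivision {e : C.E} (hs : 0 < C.slope e) (x : M.carrier) :
    x ∈ partialSums ((minSubdivision hT).pieces e) ↔ (∃ y, x + y = C.len e) ∧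
      C.α (C.src e) + C.slope e • of x ∈ Set.range C.α := by
  change x ∈ partialSums (minPieces hT e) ↔ _
  rw [minPieces_of_pos hT hs]
  exact (exists_chain hT e hs).choose_spec.2.2 x

theorem val_minSubdivision_mem (e : C.E) {j : ℕ} (hj : j ≤ ((minSubdivision hT).pieces e).length) :
    (minSubdivision hT).val e j ∈ Set.range C.α := by
  rcases lt_trichotomy (C.slope e) 0 with hs | hs | hs
  · obtain ⟨k, hk⟩ := Nat.exists_eq_add_of_le hj
    have h' : 0 < C.slope (C.rev e) := by rw [C.slope_rev]; omega
    rw [← Subdivision.val_rev _ _ hk.symm]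
    exact ((mem_partialSums_minSubdivision hT h' _).1 ⟨k, by
      rw [Subdivision.pieces_rev, List.length_reverse]; omega, rfl⟩).2
  · exact ⟨C.src e, by rw [Subdivision.val, hs, zero_smul, add_zero]⟩
  · exact ((mem_partialSums_minSubdivision hT hs _).1 ⟨j, hj, rfl⟩).2

/-- Between two partial sums, the only partial sums of a list are the ends of the interval. -/
theorem sum_take_cell {l : List M.carrier} {x a b : M.carrier} {j : ℕ} (hx : x ∈ partialSums l)
    (ha : (l.take j).sum + a = x) (hb : x + b = (l.take (j + 1)).sum) :
    x = (l.take j).sum ∨ x = (l.take (j + 1)).sum := by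
  obtain ⟨k, -, rfl⟩ := hx
  rcases Nat.lt_or_ge j k with h | h
  · obtain ⟨y, hy⟩ := sum_take_add l (Nat.succ_le_of_lt h)
    exact Or.inr (eq_of_add_eq_of_add_eq hb hy)
  · obtain ⟨y, hy⟩ := sum_take_add l h
    exact Or.inl (eq_of_add_eq_of_add_eq hy ha)

/-- Divisibility enters here: without it, a value of `α` could fall on a non-integral point of an
edge, where no subdivision vertex can be placed. -/
theorem minSubdivision_cell (hD : C.Divisible) (e : C.E) {j : ℕ}
    (hj : j < ((minSubdivision hT).pieces e).length) (u : C.V)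
    (h₁ : GpLE ((minSubdivision hT).val e j) (C.α u))
    (h₂ : GpLE (C.α u) ((minSubdivision hT).val e (j + 1))) :
    C.α u = (minSubdivision hT).val e j ∨ C.α u = (minSubdivision hT).val e (j + 1) := by
  set S := minSubdivision hT
  rcases lt_trichotomy (C.slope e) 0 with hs | hs | hs
  -- For negative slope the values decrease along the chain, so the interval is degenerate; the
  -- actual condition is carried by the reversed edge.
  · left
    refine GpLE.antisymm (h₂.trans ?_) h₁
    obtain ⟨y, hy⟩ := sum_take_add (S.pieces e) j.le_succ
    refine ⟨(-C.slope e).toNat • y, ?_⟩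
    rw [map_nsmul, ← natCast_zsmul, Int.toNat_of_nonneg (by omega), Subdivision.val,
      Subdivision.val, ← hy, map_add, smul_add, neg_smul]
    abel
  · left
    have hv : ∀ k, S.val e k = C.α (C.src e) := fun k => by
      rw [Subdivision.val, hs, zero_smul, add_zero]
    rw [hv] at h₁ h₂ ⊢
    exact h₂.antisymm h₁
  · have hle : ∀ z : M.carrier, ∃ d : M.carrier, C.slope e • of z = of d := fun z =>
      ⟨(C.slope e).toNat • z, by rw [map_nsmul, ← natCast_zsmul, Int.toNat_of_nonneg hs.le]⟩
    have mono : ∀ {a b : ℕ}, a ≤ b → GpLE (S.val e a) (S.val e b) := fun {a b} hab => by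
      obtain ⟨y, hy⟩ := sum_take_add (S.pieces e) hab
      obtain ⟨d, hd⟩ := hle y
      exact ⟨d, by rw [← hd, Subdivision.val, Subdivision.val, ← hy, map_add, smul_add]; abel⟩
    -- Divisibility gives the position `z` of `α u` in `M^gp`. Dividing the two inequalities by the
    -- slope puts `z` in `M` between consecutive partial sums, and `z` is itself a partial sum.
    obtain ⟨z, hz⟩ := hD e hs u (S.val_zero e ▸ (mono j.zero_le).trans h₁)
      (S.val_length e ▸ h₂.trans (mono hj))
    obtain ⟨d₁, hd₁⟩ := h₁
    obtain ⟨d₂, hd₂⟩ := h₂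
    have hz' : C.α u = C.α (C.src e) + C.slope e • z := by rw [← hz]; abel
    rw [Subdivision.val, hz'] at hd₁ hd₂
    obtain ⟨a, ha⟩ := exists_of_zsmul_eq_of (x := z - of ((S.pieces e).take j).sum) (m := d₁) hs
      (by rw [← hd₁, smul_sub]; abel)
    obtain ⟨b, hb⟩ := exists_of_zsmul_eq_of (x := of ((S.pieces e).take (j + 1)).sum - z)
      (m := d₂) hs (by rw [← hd₂, smul_sub]; abel)
    obtain rfl : z = of (((S.pieces e).take j).sum + a) := by rw [map_add, ← ha]; abel
    have hb' : (((S.pieces e).take j).sum + a) + b = ((S.pieces e).take (j + 1)).sum :=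
      of_injective M (by rw [map_add, ← hb]; abel)
    have hx : ((S.pieces e).take j).sum + a ∈ partialSums (S.pieces e) := by
      rw [mem_partialSums_minSubdivision hT hs]
      refine ⟨⟨b + ((S.pieces e).drop (j + 1)).sum, ?_⟩, u, hz'⟩
      rw [← add_assoc, hb', ← List.sum_append, List.take_append_drop, S.sum_pieces]
    refine (sum_take_cell hx rfl hb').imp (fun h => ?_) fun h => ?_ <;>
    rw [hz', h, Subdivision.val]

/-- The stable lift of a totally ordered function. -/
noncomputable def minLift (hD : C.Divisible) : StableLift C where
  toSubdivision := minSubdivision hT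
  line :=
    { verts := Set.range C.α
      finite_verts := haveI := C.finite_V; Set.finite_range _
      total := by
        rintro _ ⟨v, rfl⟩ _ ⟨w, rfl⟩
        exact hT v w }
  vertex_mem v := ⟨v, rfl⟩
  chain_mem e _ hj := val_minSubdivision_mem hT e hj
  edge_cell e j hj := by
    rintro _ ⟨u, rfl⟩ h₁ h₂
    exact minSubdivision_cell hT hD e hj u h₁ h₂
  line_stable _ h := h
  contracted _ h := minPieces_of_zero hT h

end Lifts

/-! ### The map `Σ_Rub → Σ_Ord` -/

section RubToOrd

universe u v

variable {B : Type u} [Category.{v} B] (U : B ⥤ SharpMon)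

instance rubToOrd_faithful : (rubToOrd U).Faithful :=
  ⟨fun h => RubHom.ext (congrArg (fun k => k.hom) h)⟩

/-- Compatibility with lines and subdivisions is automatic, since stable lifts are determined by the
function. -/
instance rubToOrd_full : (rubToOrd U).Full := by
  refine ⟨fun {X Y} h => ?_⟩
  have hc := DivHom.isContraction h.hom
  refine ⟨⟨h.hom, ?_, fun e => hc.pieces X.lift Y.lift e⟩, rfl⟩
  rw [StableLift.line_verts, StableLift.line_verts, ← Set.range_comp]
  ext x
  constructor
  · rintro ⟨v, rfl⟩
    obtain ⟨w, rfl⟩ := hc.vert_surjective v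
    exact ⟨w, (hc.α w).symm⟩
  · rintro ⟨w, rfl⟩
    exact ⟨_, hc.α w⟩

/-- Elements of `ℝ≥0` can be divided by any positive slope, so every totally ordered function is
divisible and has its minimal lift. -/
theorem rubToOrd_realBase_isEquivalence : (rubToOrd realBase).IsEquivalence where
  essSurj := by
    refine ⟨fun Y => ?_⟩
    have hD : Y.obj.curve.Divisible := fun e hs u ⟨m, hm⟩ _ => by
      obtain ⟨n, hn⟩ : ∃ n : ℕ, Y.obj.curve.slope e = n :=
        ⟨_, (Int.toNat_of_nonneg hs.le).symm⟩
      have hn0 : (n : NNReal) ≠ 0 := by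
        rintro h0
        rw [Nat.cast_eq_zero] at h0
        rw [hn, h0] at hs
        exact lt_irrefl _ hs
      obtain ⟨r, hr⟩ : ∃ r : realMon.carrier, m = n • r := by
        let r : NNReal := m
        let t : NNReal := r / (n : NNReal)
        exact ⟨t, ((nsmul_eq_mul n t).trans (mul_div_cancel₀ r hn0)).symm⟩
      refine ⟨of r, hm.trans ?_⟩
      rw [hn, natCast_zsmul, hr]
      exact map_nsmul of n r
    exact ⟨⟨Y.obj, minLift Y.property hD⟩, ⟨Iso.refl _⟩⟩

end RubToOrd

/-! ### The main theorem -/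

/-- The extra map `k` absorbs the isomorphism in the definition of the essential image. -/
theorem IsContraction.gpLE_total {M P Q : Type} [AddCommMonoid M] [AddCommMonoid P]
    [AddCommMonoid Q] {f : M →+ P} {C : PLCurve M} {D : PLCurve P} {v : C.V → D.V} {ε : D.E → C.E}
    (h : IsContraction f C D v ε) (hD : D.TotallyOrdered) {k : P →+ Q} {g : M →+ Q}
    (hg : g = k.comp f) (x y : C.V) :
    GpLE (gpMap g (C.α x)) (gpMap g (C.α y)) ∨ GpLE (gpMap g (C.α y)) (gpMap g (C.α x)) := by
  have hv : ∀ x, gpMap g (C.α x) = gpMap k (D.α (v x)) := fun x => by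
    rw [hg, gpMap_comp, h.α]; rfl
  rw [hv, hv]
  exact (hD (v x) (v y)).imp (GpLE.map k) (GpLE.map k)

theorem ordToDiv_isSubdivision : IsSubdivision (ordToDiv Mon.incl) (divBase Mon.incl) := by
  intro y
  have := y.curve.finite_V
  let α := y.curve.α
  obtain ⟨Δ, hΔ, hf⟩ := exists_subdivision y.base
    (Set.range fun p : y.curve.V × y.curve.V => α p.1 - α p.2) (Set.finite_range _) (by
      rintro _ ⟨⟨v, w⟩, rfl⟩
      exact ⟨(w, v), (neg_sub _ _).symm⟩)
  have hcomm : ∀ (P : Mon) (f : y.base.obj.carrier →+ P.obj.carrier),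
      (∃ τ ∈ Δ, ∀ ψ ∈ dualCone P.obj.carrier, AddMonoidHom.comp ψ (gpMap f) ∈ τ) ↔
        ∀ v w, GpLE (gpMap f (α v)) (gpMap f (α w)) ∨ GpLE (gpMap f (α w)) (gpMap f (α v)) := by
    intro P f
    rw [hf]
    constructor
    · intro h v w
      refine (h _ ⟨(w, v), rfl⟩).imp ?_ ?_ <;> rintro ⟨m, hm⟩ <;>
      exact ⟨m, by rw [← hm, map_sub]; abel⟩
    · rintro h _ ⟨⟨w, v⟩, rfl⟩
      refine (h v w).imp ?_ ?_ <;> rintro ⟨m, hm⟩ <;>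
      exact ⟨m, by rw [← hm, map_sub]; abel⟩
  obtain ⟨hfull, hfaith⟩ := baseChange_fullyFaithful (ordToDiv Mon.incl) (divBase Mon.incl) y
    (fun h _ _ hb hm => DivObj.hom_ext h hb hm) (fun h k g hg => DivObj.exists_factor h k g hg)
  refine ⟨Δ, hΔ, hfull, hfaith, fun g => ?_⟩
  refine Iff.trans ?_ (hcomm g.right (SharpMon.hom g.hom.hom)).symm
  constructor
  · rintro ⟨a, ⟨i⟩⟩ v w
    have hc := DivHom.isContraction a.hom
    have hi : SharpMon.hom g.hom.hom =
        (SharpMon.hom i.hom.right.hom).comp (SharpMon.hom (DivHom.base a.hom).hom) :=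
      congrArg (fun k => SharpMon.hom k.hom) (Under.w i.hom).symm
    exact hc.gpLE_total a.right.property hi v w
  · intro h
    -- The pushforward of `y` realizes `g`: its values are the `gpMap` images of those of `y`, which
    -- `h` makes comparable.
    let x : OrdObj Mon.incl := ⟨⟨g.right, pushforward (SharpMon.hom g.hom.hom) y.curve⟩, by
      intro v w
      induction v using Quotient.ind with | _ v => ?_
      induction w using Quotient.ind with | _ w => ?_
      exact h v w⟩
    exact ⟨StructuredArrow.mk (Y := x) (DivObj.push y g.hom), ⟨Iso.refl _⟩⟩

/-! ### The finite index lattice and `Σ_Rub → Σ_Ord` -/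

/-- The functionals with integral values on the differences that have to be divisible by slopes. -/
noncomputable def slopeLattice {M : Type} [AddCommMonoid M] (C : PLCurve M) : AddSubgroup (Lattice M) :=
  ⨅ q : {q : C.E × C.V // 0 < C.slope q.1 ∧ GpLE (C.α (C.src q.1)) (C.α q.2) ∧
      GpLE (C.α q.2) (C.α (C.tgt q.1))},
    ((Int.castAddHom (ZMod (C.slope q.1.1).natAbs)).comp
      (AddMonoidHom.eval (C.α q.1.2 - C.α (C.src q.1.1)))).ker

theorem mem_slopeLattice {M : Type} [AddCommMonoid M] {C : PLCurve M} {ψ : Lattice M} :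
    ψ ∈ slopeLattice C ↔ ∀ e, 0 < C.slope e → ∀ u, GpLE (C.α (C.src e)) (C.α u) →
      GpLE (C.α u) (C.α (C.tgt e)) → C.slope e ∣ ψ (C.α u - C.α (C.src e)) := by
  have key : ∀ (s a : ℤ), (a : ZMod s.natAbs) = 0 ↔ s ∣ a := fun s a => by
    rw [ZMod.intCast_zmod_eq_zero_iff_dvd, Int.natAbs_dvd]
  rw [slopeLattice, AddSubgroup.mem_iInf]
  constructor
  · intro h e hs u h₁ h₂
    exact (key _ _).1 (h ⟨(e, u), hs, h₁, h₂⟩)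
  · rintro h ⟨⟨e, u⟩, hs, h₁, h₂⟩
    exact (key _ _).2 (h e hs u h₁ h₂)

/-- There are finitely many pairs of an edge and a vertex, and each contributes the kernel of a map
to a finite cyclic group. -/
theorem slopeLattice_finiteIndex {M : Type} [AddCommMonoid M] (C : PLCurve M) :
    (slopeLattice C).FiniteIndex := by
  have := C.finite_V
  have := C.finite_E
  refine AddSubgroup.finiteIndex_iInf fun q => ?_
  have : NeZero (C.slope q.1.1).natAbs := ⟨Int.natAbs_ne_zero.2 q.2.1.ne'⟩
  exact AddSubgroup.finiteIndex_ker _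

/-- The pushforward of a totally ordered function is divisible if and only if the map sends the
lattice into the lattice given by the slopes. -/
theorem IsContraction.divisible_iff {M : SharpMon} {P : Mon}
    {f : M.carrier →+ P.obj.carrier} {C : PLCurve M.carrier} {D : PLCurve P.obj.carrier}
    {v : C.V → D.V} {ε : D.E → C.E} (h : IsContraction f C D v ε) (hT : C.TotallyOrdered) :
    D.Divisible ↔ ∀ ψ : Lattice P.obj.carrier, ψ.comp (gpMap f) ∈ slopeLattice C := by
  have hdiff : ∀ e u, gpMap f (C.α u - C.α (C.src (ε e))) = D.α (v u) - D.α (D.src e) :=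
    fun e u => by rw [map_sub, ← h.edge_src, h.α, h.α]
  constructor
  · intro hD ψ
    rw [mem_slopeLattice]
    intro e hs u h₁ h₂
    rw [AddMonoidHom.comp_apply]
    by_cases h0 : f (C.len e) = 0
    -- On a contracted edge both ends acquire the same value, and `u` between them does too, so the
    -- congruence is trivial.
    · have heq : gpMap f (C.α (C.tgt e)) = gpMap f (C.α (C.src e)) := by
        rw [← sub_eq_zero, ← map_sub, C.slope_spec, map_zsmul, gpMap_of, h0, map_zero, smul_zero]
      have := (heq ▸ h₂.map f).antisymm (h₁.map f)
      rw [map_sub, this, sub_self, map_zero]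
      exact dvd_zero _
    · obtain ⟨e, rfl⟩ := (h.edge_range e).2 h0
      obtain ⟨z, hz⟩ := hD e (by rwa [h.slope]) (v u)
        (by rw [← h.edge_src, h.α, h.α]; exact h₁.map f)
        (by rw [← h.tgt_edge, h.α, h.α]; exact h₂.map f)
      rw [hdiff, hz, map_zsmul, h.slope, smul_eq_mul]
      exact dvd_mul_right _ _
  · intro hN e hs u' h₁ h₂
    obtain ⟨u, rfl⟩ := h.vert_surjective u'
    have hs' : 0 < C.slope (ε e) := by rwa [← h.slope]
    -- A vertex on the segment over `P` but outside it over `M` takes the value of an end of the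
    -- edge, where divisibility is clear. Only the remaining case uses the lattice.
    rcases hT (C.src (ε e)) u with k₁ | k₁
    · rcases hT u (C.tgt (ε e)) with k₂ | k₂
      · refine exists_zsmul_eq_of_lattice fun ψ => ?_
        rw [← hdiff, h.slope]
        exact mem_slopeLattice.1 (hN ψ) _ hs' u k₁ k₂
      · have := k₂.map f
        rw [← h.α, ← h.α, h.tgt_edge] at this
        exact ⟨of (D.len e), by rw [h₂.antisymm this, D.slope_spec]⟩
    · have := k₁.map f
      rw [← h.α, ← h.α, h.edge_src] at this
      exact ⟨0, by rw [this.antisymm h₁, sub_self, smul_zero]⟩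

theorem IsContraction.comp_mem_slopeLattice {M : SharpMon} {P Q : Mon}
    {f : M.carrier →+ P.obj.carrier} {C : PLCurve M.carrier} {D : PLCurve P.obj.carrier}
    {v : C.V → D.V} {ε : D.E → C.E} (h : IsContraction f C D v ε) (hT : C.TotallyOrdered)
    (L : StableLift D) {k : P.obj.carrier →+ Q.obj.carrier} {g : M.carrier →+ Q.obj.carrier}
    (hg : g = k.comp f) (ψ : Lattice Q.obj.carrier) : ψ.comp (gpMap g) ∈ slopeLattice C := by
  rw [hg, gpMap_comp, ← AddMonoidHom.comp_assoc]
  exact (h.divisible_iff hT).1 (StableLift.divisible (M := P.obj) L) _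

theorem rubToOrd_isFiniteIndexInclusion :
    IsFiniteIndexInclusion (rubToOrd Mon.incl) (ordToDiv Mon.incl ⋙ divBase Mon.incl) := by
  intro y
  refine ⟨slopeLattice y.obj.curve, slopeLattice_finiteIndex _, ?_⟩
  obtain ⟨hfull, hfaith⟩ := baseChange_fullyFaithful (rubToOrd Mon.incl)
    (ordToDiv Mon.incl ⋙ divBase Mon.incl) y
    -- `Σ_Ord` is a full subcategory of `Σ_Div`, so its arrows inherit the cocartesian property.
    (fun h _ _ hb hm => (ordToDiv Mon.incl).map_injective
      (DivObj.hom_ext h.hom hb (congrArg (fun k => k.hom) hm)))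
    (fun h k g hg => by
      obtain ⟨m, hm, hk⟩ := DivObj.exists_factor h.hom k.hom g hg
      exact ⟨ObjectProperty.homMk m, hm, ObjectProperty.hom_ext _ hk⟩)
  refine ⟨hfull, hfaith, fun g => ?_⟩
  constructor
  · rintro ⟨a, ⟨i⟩⟩ ψ
    have hc := DivHom.isContraction a.hom.hom
    have hi : SharpMon.hom g.hom.hom =
        (SharpMon.hom i.hom.right.hom).comp (SharpMon.hom (DivHom.base a.hom.hom).hom) :=
      congrArg (fun k => SharpMon.hom k.hom) (Under.w i.hom).symm
    exact hc.comp_mem_slopeLattice y.property a.right.lift hi ψ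
  · intro hN
    have hc := isContraction_pushforward (SharpMon.hom g.hom.hom) y.obj.curve
    have hT : (pushforward (SharpMon.hom g.hom.hom) y.obj.curve).TotallyOrdered := by
      intro v w
      induction v using Quotient.ind with | _ v => ?_
      induction w using Quotient.ind with | _ w => ?_
      exact (y.property v w).imp (GpLE.map _) (GpLE.map _)
    let x : RubObj Mon.incl := ⟨⟨g.right, pushforward (SharpMon.hom g.hom.hom) y.obj.curve⟩,
      minLift (M := g.right.obj) hT ((hc.divisible_iff y.property).2 hN)⟩
    exact ⟨StructuredArrow.mk (Y := x) (ObjectProperty.homMk (DivObj.push y.obj g.hom)),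
      ⟨Iso.refl _⟩⟩

end TropRub

theorem mainTheorem8 :
    TropRub.IsSubdivision (TropRub.ordToDiv TropRub.Mon.incl) (TropRub.divBase TropRub.Mon.incl) ∧
    TropRub.IsFiniteIndexInclusion (TropRub.rubToOrd TropRub.Mon.incl)
      (CategoryTheory.Functor.comp (TropRub.ordToDiv TropRub.Mon.incl)
        (TropRub.divBase TropRub.Mon.incl)) ∧
    (TropRub.rubToOrd TropRub.realBase).IsEquivalence := by
  exact ⟨TropRub.ordToDiv_isSubdivision, TropRub.rubToOrd_isFiniteIndexInclusion,
    TropRub.rubToOrd_realBase_isEquivalence⟩
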